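/- Let $\Omega\subset\mathbb R^3$ be a bounded open set with smooth boundary $\Gamma$, let $T>0$, $\kappa>0$ and let $e\in\mathbb R^3$ with $|e|=1$. Put $H=L^2(\Omega)$ and $V=H^1(\Omega)$ with their standard norms, identify $H$ with a subspace of the dual $V^*$ through $\langle h,v\rangle=\int_\Omega hv$, and write $W^{k,p}(X)$, $H^k(X)=W^{k,2}(X)$, $L^p(X)$, $C^k(X)$ for the spaces of functions from $(0,T)$ (from $[0,T]$ in the last case) to a Banach space $X$. Let $G:\mathbb R\to\mathbb R$ be a nonnegative $C^1$ function with $G(0)=0$ such that $G$ and $G'$ are bounded and $G'$ is Lipschitz continuous, and let $\gamma(r)=G(r)\,\mathrm{sign}(r)$ (with $\mathrm{sign}(0)=0$). Let $B_\Omega\in L^2(H)$ $(=L^2(\Omega\times(0,T)))$, $b_\Gamma\in H^1(L^2(\Gamma))$, $u_0\in V$, $u_0'\in H$, let $B_\Gamma\in H^1(V^*)$ be defined by $\langle B_\Gamma(t),v\rangle=\int_\Gamma b_\Gamma(t)\,v$ for $v\in V$ (with the trace of $v$ on $\Gamma$), and put $B=B_\Omega+B_\Gamma$. Assume that $$u\in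 W^{2,1}(V^*)\cap W^{1,\infty}(H)\cap L^\infty(V),\qquad \sigma\in L^\infty(H^3),\qquad \chi\in H^1(H)$$ satisfy $$\sigma=\kappa\nabla u-\gamma(\chi)e\quad\text{a.e. in }\Omega\times(0,T),$$ $$\langle\partial_t^2u,v\rangle+\int_\Omega\sigma\cdot\nabla v=\langle B,v\rangle\quad\text{a.e. in }(0,T)\text{ and for every }v\in V,$$ $$u(0)=u_0,\qquad \partial_tu(0)=u_0'.$$ Then (up to the choice of the continuous representatives) $u\in H^2(V^*)\cap C^1(H)\cap C^0(V)$ and $\sigma\in C^0(H^3)$. Moreover $\gamma(\chi)\in H^1(H)$, and for every $t\in[0,T]$ $$\frac\kappa2\int_\Omega|\partial_tu(t)|^2-\frac\kappa2\int_\Omega|u_0'|^2+\frac12\int_\Omega|\sigma(t)|^2-\frac12\int_\Omega|\sigma(0)|^2+\int_0^t\!\!\int_\Omega\sigma\cdot e\;\partial_t\gamma(\chi)$$ $$=\kappa\int_0^t\!\!\int_\Omega B_\Omega\,\partial_tu+\kappa\langle B_\Gamma(t),u(t)\rangle-\kappa\langle B_\Gamma(0),u_0\rangle-\kappa\int_0^t\langle\partial_tB_\Gamma(s),u(s)\rangle\,ds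 .$$ -/

import Mathlib

open Set Filter Topology MeasureTheory
open scoped ENNReal ContDiff RealInnerProductSpace

namespace Thermo

/-- The ambient space `ℝ³` with its Euclidean norm. -/
abbrev E3 : Type := EuclideanSpace ℝ (Fin 3)

/-- `Ω` has a smooth boundary: near each boundary point, `Ω` is the sublevel set `{φ < 0}`
of a smooth function `φ` whose differential does not vanish at that point. -/
def HasSmoothBoundary (Ω : Set E3) : Prop :=
  ∀ x ∈ frontier Ω, ∃ U : Set E3, IsOpen U ∧ x ∈ U ∧
    ∃ φ : E3 → ℝ, ContDiff ℝ ∞ φ ∧ fderiv ℝ φ x ≠ 0 ∧ Ω ∩ U = {y ∈ U | φ y < 0}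

/-- `H = L²(Ω)`. -/
abbrev H (Ω : Set E3) : Type := Lp ℝ 2 (volume.restrict Ω)

/-- `H³ = L²(Ω; ℝ³)`. -/
abbrev HH (Ω : Set E3) : Type := Lp E3 2 (volume.restrict Ω)

/-- `L²(Γ)`, where `Γ = ∂Ω` carries the surface measure (the two-dimensional Hausdorff measure,
normalized so as to agree with the area on planes). -/
abbrev L2Bdry (Ω : Set E3) : Type := Lp ℝ 2 ((μHE[2] : Measure E3).restrict (frontier Ω))

/-- `F` is the weak gradient of `f` in `Ω`: for every test function `φ ∈ C_c^∞(Ω)` and every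
direction `w`, `∫_Ω f ∂_w φ = - ∫_Ω (F · w) φ`. -/
def IsWeakGrad (Ω : Set E3) (f : H Ω) (F : HH Ω) : Prop :=
  ∀ φ : E3 → ℝ, ContDiff ℝ ∞ φ → HasCompactSupport φ → tsupport φ ⊆ Ω → ∀ w : E3,
    ∫ x in Ω, f x * fderiv ℝ φ x w = - ∫ x in Ω, ⟪F x, w⟫ * φ x

theorem integrable_mul_test {Ω : Set E3} (f : H Ω) {ψ : E3 → ℝ} (hc : Continuous ψ)
    (hs : HasCompactSupport ψ) : Integrable (fun x => f x * ψ x) (volume.restrict Ω) := by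
  have h2 : MemLp ψ 2 (volume.restrict Ω) :=
    (hc.memLp_of_hasCompactSupport (μ := volume) hs).restrict Ω
  exact (Lp.memLp f).integrable_mul h2

theorem integrable_inner_mul_test {Ω : Set E3} (F : HH Ω) (w : E3) {ψ : E3 → ℝ}
    (hc : Continuous ψ) (hs : HasCompactSupport ψ) :
    Integrable (fun x => ⟪F x, w⟫ * ψ x) (volume.restrict Ω) := by
  have h2 : MemLp ψ 2 (volume.restrict Ω) :=
    (hc.memLp_of_hasCompactSupport (μ := volume) hs).restrict Ω
  exact ((Lp.memLp F).inner_const w).integrable_mul h2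

theorem continuous_fderiv_apply_test {φ : E3 → ℝ} (hφ : ContDiff ℝ ∞ φ) (w : E3) :
    Continuous (fun x => fderiv ℝ φ x w) :=
  (hφ.continuous_fderiv (by simp)).clm_apply continuous_const

/-- `H¹(Ω)` as the space of pairs `(f, ∇f)` in `L²(Ω) × L²(Ω; ℝ³)`; the inherited norm is the
standard one, `‖v‖² = ‖v‖²_{L²} + ‖∇v‖²_{L²}`. -/
def sobolevSubmodule (Ω : Set E3) : Submodule ℝ (WithLp 2 (H Ω × HH Ω)) where
  carrier := {p | IsWeakGrad Ω p.fst p.snd}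
  zero_mem' := by
    intro φ hφ hs ht w
    have h1 : ∫ x in Ω, (0 : H Ω) x * fderiv ℝ φ x w = 0 := by
      apply integral_eq_zero_of_ae
      filter_upwards [Lp.coeFn_zero ℝ 2 (volume.restrict Ω)] with x hx
      rw [hx, Pi.zero_apply, zero_mul]
    have h2 : ∫ x in Ω, ⟪(0 : HH Ω) x, w⟫ * φ x = 0 := by
      apply integral_eq_zero_of_ae
      filter_upwards [Lp.coeFn_zero E3 2 (volume.restrict Ω)] with x hx
      rw [hx, Pi.zero_apply, inner_zero_left, zero_mul]; rfl
    exact h1.trans (by rw [← neg_zero, ← h2]; rfl)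
  add_mem' := by
    intro p q hp hq φ hφ hs ht w
    have e1 : ∫ x in Ω, (p.fst + q.fst) x * fderiv ℝ φ x w
        = (∫ x in Ω, p.fst x * fderiv ℝ φ x w) + ∫ x in Ω, q.fst x * fderiv ℝ φ x w := by
      rw [← integral_add
        (integrable_mul_test _ (continuous_fderiv_apply_test hφ w) (hs.fderiv_apply ℝ w))
        (integrable_mul_test _ (continuous_fderiv_apply_test hφ w) (hs.fderiv_apply ℝ w))]
      apply integral_congr_ae
      filter_upwards [Lp.coeFn_add p.fst q.fst] with x hx
      rw [hx, Pi.add_apply, add_mul]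
    have e2 : ∫ x in Ω, ⟪(p.snd + q.snd) x, w⟫ * φ x
        = (∫ x in Ω, ⟪p.snd x, w⟫ * φ x) + ∫ x in Ω, ⟪q.snd x, w⟫ * φ x := by
      rw [← integral_add (integrable_inner_mul_test _ w hφ.continuous hs)
        (integrable_inner_mul_test _ w hφ.continuous hs)]
      apply integral_congr_ae
      filter_upwards [Lp.coeFn_add p.snd q.snd] with x hx
      rw [hx, Pi.add_apply, inner_add_left, add_mul]
    have hp' := hp φ hφ hs ht w
    have hq' := hq φ hφ hs ht w
    change ∫ x in Ω, (p.fst + q.fst) x * fderiv ℝ φ x w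
      = - ∫ x in Ω, ⟪(p.snd + q.snd) x, w⟫ * φ x
    rw [e1, e2, hp', hq', neg_add]
  smul_mem' := by
    intro c p hp φ hφ hs ht w
    have e1 : ∫ x in Ω, (c • p.fst) x * fderiv ℝ φ x w
        = c * ∫ x in Ω, p.fst x * fderiv ℝ φ x w := by
      rw [← integral_const_mul]
      apply integral_congr_ae
      filter_upwards [Lp.coeFn_smul c p.fst] with x hx
      rw [hx, Pi.smul_apply, smul_eq_mul, mul_assoc]
    have e2 : ∫ x in Ω, ⟪(c • p.snd) x, w⟫ * φ x
        = c * ∫ x in Ω, ⟪p.snd x, w⟫ * φ x := by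
      rw [← integral_const_mul]
      apply integral_congr_ae
      filter_upwards [Lp.coeFn_smul c p.snd] with x hx
      rw [hx, Pi.smul_apply, real_inner_smul_left, mul_assoc]
    have hp' := hp φ hφ hs ht w
    change ∫ x in Ω, (c • p.fst) x * fderiv ℝ φ x w
      = - ∫ x in Ω, ⟪(c • p.snd) x, w⟫ * φ x
    rw [e1, e2, hp', mul_neg]

/-- `V = H¹(Ω)`. -/
abbrev V (Ω : Set E3) : Type := ↥(sobolevSubmodule Ω)

/-- `V*`, the topological dual of `V`. -/
abbrev VDual (Ω : Set E3) : Type := V Ω →L[ℝ] ℝ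

/-- The embedding `V ⊂ H`. -/
noncomputable def toH (Ω : Set E3) : V Ω →L[ℝ] H Ω :=
  (WithLp.fstL 2 ℝ (H Ω) (HH Ω)).comp (sobolevSubmodule Ω).subtypeL

/-- The weak gradient `∇ : V → H³`. -/
noncomputable def grad (Ω : Set E3) : V Ω →L[ℝ] HH Ω :=
  (WithLp.sndL 2 ℝ (H Ω) (HH Ω)).comp (sobolevSubmodule Ω).subtypeL

/-- The embedding `H ⊂ V*`, `⟨h, v⟩ = ∫_Ω h v`. -/
noncomputable def toDual (Ω : Set E3) : H Ω →L[ℝ] VDual Ω :=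
  ((toH Ω).precomp ℝ).comp (innerSL ℝ)

/-- `tr` is the trace operator of `Ω`: the continuous linear operator from `H¹(Ω)` to `L²(Γ)`
that sends (the restriction to `Ω` of) a smooth function to its restriction to `Γ`. -/
def IsTraceOperator (Ω : Set E3) (tr : V Ω →L[ℝ] L2Bdry Ω) : Prop :=
  ∀ φ : E3 → ℝ, ContDiff ℝ ∞ φ → ∀ v : V Ω, (toH Ω v =ᵐ[volume.restrict Ω] φ) →
    tr v =ᵐ[(μHE[2] : Measure E3).restrict (frontier Ω)] φ

open Classical in
/-- The trace operator `H¹(Ω) → L²(Γ)`. For a bounded open set with a smooth boundary, there is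
exactly one operator as in `IsTraceOperator`, by the trace theorem and by the density of the
restrictions of smooth functions in `H¹(Ω)`. -/
noncomputable def trace (Ω : Set E3) : V Ω →L[ℝ] L2Bdry Ω :=
  if h : ∃ tr, IsTraceOperator Ω tr then h.choose else 0

/-- The functional `v ↦ ∫_Γ b v` on `V`, for `b ∈ L²(Γ)`. -/
noncomputable def bdryFunctional (Ω : Set E3) (b : L2Bdry Ω) : VDual Ω :=
  (innerSL ℝ b).comp (trace Ω)

open Classical in
/-- The superposition operator `h ↦ g ∘ h` on `L²(Ω)`, where `g ∘ h` is square integrable. -/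
noncomputable def superpose (Ω : Set E3) (g : ℝ → ℝ) (h : H Ω) : H Ω :=
  if hg : MemLp (fun x => g (h x)) 2 (volume.restrict Ω) then hg.toLp else 0

section Time

variable {X : Type*} [NormedAddCommGroup X] [NormedSpace ℝ X]

/-- Lebesgue measure on the time interval `(0, T)`. -/
noncomputable abbrev timeMeasure (T : ℝ) : Measure ℝ := volume.restrict (Ioo 0 T)

/-- `g` is the weak derivative of `f : (0, T) → X`. -/
def IsWeakTimeDeriv [CompleteSpace X] (T : ℝ) (f g : ℝ → X) : Prop :=
  Integrable f (timeMeasure T) ∧ Integrable g (timeMeasure T) ∧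
  ∀ φ : ℝ → ℝ, ContDiff ℝ ∞ φ → HasCompactSupport φ → tsupport φ ⊆ Ioo 0 T →
    ∫ t in Ioo 0 T, deriv φ t • f t = - ∫ t in Ioo 0 T, φ t • g t

/-- `f ∈ W^{k,p}(0, T; X)`. -/
def MemBochnerSobolev [CompleteSpace X] (T : ℝ) : ℕ → ℝ≥0∞ → (ℝ → X) → Prop
  | 0, p, f => MemLp f p (timeMeasure T)
  | k + 1, p, f => MemLp f p (timeMeasure T) ∧
      ∃ g : ℝ → X, IsWeakTimeDeriv T f g ∧ MemBochnerSobolev T k p g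

/-- `g ∈ C⁰([0, T]; X)` is the continuous representative of `f`. -/
def IsContRep (T : ℝ) (f g : ℝ → X) : Prop :=
  ContinuousOn g (Icc 0 T) ∧ f =ᵐ[timeMeasure T] g

/-- `f(0) = x`, in the sense of the continuous representative of `f`. -/
def HasInitialValue (T : ℝ) (f : ℝ → X) (x : X) : Prop :=
  ∃ g : ℝ → X, IsContRep T f g ∧ g 0 = x

/-- `f ∈ C¹([0, T]; X)` with derivative `f'`. -/
def IsC1With (T : ℝ) (f f' : ℝ → X) : Prop :=
  (∀ t ∈ Icc 0 T, HasDerivWithinAt f (f' t) (Icc 0 T) t) ∧ ContinuousOn f' (Icc 0 T)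

end Time

end Thermo

open Thermo

/-! The formal proof multiplies the momentum equation by `∂ₜu`, which is not allowed: `∂ₜu` lies
only in `H`, while the equation holds in `V*`. It has to be regularized in space, by an operator
that commutes with the wave operator so that no commutator is left to estimate.

Let `ι : V → H` be the embedding and identify `V*` with `V` by Riesz. The equation becomes `(ι*ι
u)'' + κ u = ι* F₁ + F₂` in `V`, with `F₁ = B_Ω + κ u` and `F₂` made of `B_Γ` and of `grad*(γ(χ)
e)`; the term `κ u` in `F₁` compensates the zero-order part of the inner product of `V`. The
resolvent `Q = (ι*ι + ε)⁻¹` commutes with `ι*ι`, and `Q y` with `y = ι*ι u` is absolutely continuous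
with values in `V` and tends to `u` as `ε → 0`. For every operator `Q` that commutes with `ι*ι`, the
energy identity for `Q y` is exact (`IsWave.isPrim_energy`) and bounds `Q y` uniformly in time by
the regularized data (`IsWave.norm_le`). Differences of two resolvents also commute with `ι*ι`, so
the same bound shows that the regularized solutions are uniformly Cauchy on `[0, T]`. This gives `u
∈ C⁰(V)`, `∂ₜu ∈ C⁰(H)` and, in the limit, the energy identity (`IsWave.exists_continuous_energy`).

`F₂` takes values only in `V ≅ V*`, so its work is integrated by parts in time; this needs `∂ₜγ(χ)`.
Since `G ≥ 0 = G(0)` forces `G'(0) = 0`, `γ` is `C¹` with Lipschitz derivative. Superposition with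
`γ` need not be Fréchet differentiable on `L²`, but its pairing with a bounded function is, and this
suffices for the chain rule (`HasLipschitzDeriv.isPrim_superpose`). Expanding `|κ∇u - γ(χ) e|²` with
`|e| = 1` turns the wave energy into the stress energy (`isPrim_stress_energy`). -/

namespace Thermo

/-! ### Integrable and continuous functions on the time interval -/

section TimeMeasure

variable {X : Type*} [NormedAddCommGroup X]

theorem intervalIntegrable_of_integrable_timeMeasure {T : ℝ} {f : ℝ → X}
    (hf : Integrable f (timeMeasure T)) {t : ℝ} (ht : t ∈ Icc 0 T) :
    IntervalIntegrable f volume 0 t := by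
  have h1 : IntegrableOn f (Ioc 0 T) volume :=
    (integrableOn_Ioc_iff_integrableOn_Ioo).2 hf
  exact (intervalIntegrable_iff_integrableOn_Ioc_of_le ht.1).2
    (h1.mono_set (Ioc_subset_Ioc_right ht.2))

theorem ae_mem_Icc_timeMeasure (T : ℝ) : ∀ᵐ t ∂(timeMeasure T), t ∈ Icc 0 T := by
  filter_upwards [ae_restrict_mem measurableSet_Ioo] with t ht using Ioo_subset_Icc_self ht

theorem aestronglyMeasurable_of_continuousOn {T : ℝ} {f : ℝ → X}
    (hf : ContinuousOn f (Icc 0 T)) : AEStronglyMeasurable f (timeMeasure T) :=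
  (hf.mono Ioo_subset_Icc_self).aestronglyMeasurable measurableSet_Ioo

theorem exists_norm_le_of_continuousOn_Icc {T : ℝ} {f : ℝ → X}
    (hf : ContinuousOn f (Icc 0 T)) : ∃ C, 0 ≤ C ∧ ∀ t ∈ Icc 0 T, ‖f t‖ ≤ C := by
  obtain ⟨C, hC⟩ := isCompact_Icc.exists_bound_of_continuousOn hf
  exact ⟨max C 0, le_max_right _ _, fun t ht => (hC t ht).trans (le_max_left _ _)⟩

theorem memLp_top_of_continuousOn {T : ℝ} {f : ℝ → X}
    (hf : ContinuousOn f (Icc 0 T)) (p : ℝ≥0∞) : MemLp f p (timeMeasure T) := by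
  obtain ⟨C, _, hC⟩ := exists_norm_le_of_continuousOn_Icc hf
  refine MemLp.of_bound (aestronglyMeasurable_of_continuousOn hf) C ?_
  filter_upwards [ae_mem_Icc_timeMeasure T] with t ht using hC t ht

/-- Two continuous functions on `[0, T]` that agree almost everywhere agree everywhere. -/
theorem eqOn_Icc_of_ae_eq {T : ℝ} (hT : 0 < T) {f g : ℝ → X} (hf : ContinuousOn f (Icc 0 T))
    (hg : ContinuousOn g (Icc 0 T)) (hfg : f =ᵐ[timeMeasure T] g) : EqOn f g (Icc 0 T) := by
  have h1 : EqOn f g (Ioo 0 T) :=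
    Measure.eqOn_open_of_ae_eq hfg isOpen_Ioo (hf.mono Ioo_subset_Icc_self)
      (hg.mono Ioo_subset_Icc_self)
  refine h1.of_subset_closure hf hg Ioo_subset_Icc_self ?_
  rw [closure_Ioo hT.ne]

end TimeMeasure

/-! ### Absolutely continuous functions of time: chain and product rules -/

section TimeCalculus

variable {X Y Z : Type*} [NormedAddCommGroup X] [NormedSpace ℝ X]
  [NormedAddCommGroup Y] [NormedSpace ℝ Y] [NormedAddCommGroup Z] [NormedSpace ℝ Z]

theorem intervalIntegral_eq_timeMeasure {T : ℝ} (hT : 0 ≤ T) (f : ℝ → X) :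
    ∫ s in (0 : ℝ)..T, f s = ∫ s, f s ∂(timeMeasure T) := by
  rw [intervalIntegral.integral_of_le hT, integral_Ioc_eq_integral_Ioo]

theorem norm_intervalIntegral_le_timeMeasure {T : ℝ} {f : ℝ → X}
    (hf : Integrable f (timeMeasure T)) {t : ℝ} (ht : t ∈ Icc 0 T) :
    ‖∫ s in (0 : ℝ)..t, f s‖ ≤ ∫ s, ‖f s‖ ∂(timeMeasure T) := by
  have hT : 0 ≤ T := ht.1.trans ht.2
  refine (intervalIntegral.norm_integral_le_integral_norm ht.1).trans ?_
  rw [intervalIntegral.integral_of_le ht.1, ← integral_Ioc_eq_integral_Ioo]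
  refine setIntegral_mono_set ?_ (Eventually.of_forall fun _ => norm_nonneg _)
    (Ioc_subset_Ioc_right ht.2).eventuallyLE
  exact ((integrableOn_Ioc_iff_integrableOn_Ioo).2 hf).norm

theorem intervalIntegral_congr_timeMeasure {T : ℝ} {f g : ℝ → X}
    (hfg : f =ᵐ[timeMeasure T] g) {t : ℝ} (ht : t ∈ Icc 0 T) :
    ∫ s in (0 : ℝ)..t, f s = ∫ s in (0 : ℝ)..t, g s := by
  rw [intervalIntegral.integral_of_le ht.1, intervalIntegral.integral_of_le ht.1,
    integral_Ioc_eq_integral_Ioo, integral_Ioc_eq_integral_Ioo]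
  exact integral_congr_ae
    (ae_mono (Measure.restrict_mono (Ioo_subset_Ioo_right ht.2) le_rfl) hfg)

/-- `f` is, on `[0, T]`, a primitive of the integrable function `f'`. -/
structure IsPrim (T : ℝ) (f f' : ℝ → X) : Prop where
  integrable : Integrable f' (timeMeasure T)
  eq : ∀ t ∈ Icc 0 T, f t = f 0 + ∫ s in (0 : ℝ)..t, f' s

theorem IsPrim.continuousOn {T : ℝ} {f f' : ℝ → X} (h : IsPrim T f f') :
    ContinuousOn f (Icc 0 T) := by
  rcases le_or_gt 0 T with hT | hT
  · have h1 : IntegrableOn f' (uIcc 0 T) volume := by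
      rw [uIcc_of_le hT]
      exact (integrableOn_Icc_iff_integrableOn_Ioo).2 h.integrable
    have h2 := intervalIntegral.continuousOn_primitive_interval h1
    rw [uIcc_of_le hT] at h2
    exact (continuousOn_const.add h2).congr h.eq
  · rw [Icc_eq_empty hT.not_ge]; exact continuousOn_empty _

theorem IsPrim.integrable_self {T : ℝ} {f f' : ℝ → X} (h : IsPrim T f f') :
    Integrable f (timeMeasure T) :=
  memLp_one_iff_integrable.1 (memLp_top_of_continuousOn h.continuousOn 1)

theorem integrable_test_smul {T : ℝ} {f : ℝ → X} (hf : Integrable f (timeMeasure T)) {φ : ℝ → ℝ}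
    (hφ : Continuous φ) : Integrable (fun t => φ t • f t) (timeMeasure T) := by
  obtain ⟨C, -, hC⟩ := exists_norm_le_of_continuousOn_Icc (T := T) hφ.continuousOn
  refine hf.bdd_smul C hφ.aestronglyMeasurable ?_
  filter_upwards [ae_mem_Icc_timeMeasure T] with t ht using hC t ht

theorem IsPrim.of_integrable {T : ℝ} {f' : ℝ → X} (h : Integrable f' (timeMeasure T)) (c : X) :
    IsPrim T (fun t => c + ∫ s in (0 : ℝ)..t, f' s) f' :=
  ⟨h, fun t _ => by simp⟩

theorem IsPrim.congr_deriv {T : ℝ} {f f' g' : ℝ → X} (h : IsPrim T f f')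
    (h' : f' =ᵐ[timeMeasure T] g') : IsPrim T f g' :=
  ⟨h.integrable.congr h', fun t ht => by
    rw [h.eq t ht, intervalIntegral_congr_timeMeasure h' ht]⟩

theorem IsPrim.clm [CompleteSpace X] [CompleteSpace Y] {T : ℝ} {f f' : ℝ → X}
    (h : IsPrim T f f') (L : X →L[ℝ] Y) : IsPrim T (fun t => L (f t)) (fun t => L (f' t)) :=
  ⟨L.integrable_comp h.integrable, fun t ht => by
    rw [h.eq t ht, map_add,
      ← L.intervalIntegral_comp_comm (intervalIntegrable_of_integrable_timeMeasure h.integrable ht)]⟩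

theorem IsPrim.add {T : ℝ} {f f' g g' : ℝ → X} (hf : IsPrim T f f') (hg : IsPrim T g g') :
    IsPrim T (fun t => f t + g t) (fun t => f' t + g' t) :=
  ⟨hf.integrable.add hg.integrable, fun t ht => by
    rw [hf.eq t ht, hg.eq t ht, intervalIntegral.integral_add
      (intervalIntegrable_of_integrable_timeMeasure hf.integrable ht)
      (intervalIntegrable_of_integrable_timeMeasure hg.integrable ht)]
    abel⟩

theorem IsPrim.prodMk [CompleteSpace X] [CompleteSpace Y] {T : ℝ} {f f' : ℝ → X} {g g' : ℝ → Y}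
    (hf : IsPrim T f f') (hg : IsPrim T g g') :
    IsPrim T (fun t => (f t, g t)) (fun t => (f' t, g' t)) := by
  have h1 := hf.clm (ContinuousLinearMap.inl ℝ X Y)
  have h2 := hg.clm (ContinuousLinearMap.inr ℝ X Y)
  simpa using h1.add h2

/-- An integrable function on `(0, T)` is a limit in `L¹` of continuous functions. -/
theorem exists_continuous_integral_norm_sub_le {T : ℝ} {f : ℝ → X}
    (hf : Integrable f (timeMeasure T)) {ε : ℝ} (hε : 0 < ε) :
    ∃ g : ℝ → X, Continuous g ∧ Integrable g (timeMeasure T) ∧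
      ∫ s, ‖g s - f s‖ ∂(timeMeasure T) ≤ ε := by
  obtain ⟨g, -, h1, h2, h3⟩ := hf.exists_hasCompactSupport_integral_sub_le hε
  exact ⟨g, h2, h3, by simpa only [norm_sub_rev] using h1⟩

/-- The chain rule for a primitive and a function with a Lipschitz derivative. -/
theorem IsPrim.chain [CompleteSpace X] [CompleteSpace Y] {T : ℝ} {f f' : ℝ → X}
    (hf : IsPrim T f f') {Φ : X → Y} {Φ' : X → X →L[ℝ] Y}
    (hΦ : ∀ x, HasFDerivAt Φ (Φ' x) x) {L : ℝ} (hL : ∀ x y, ‖Φ' x - Φ' y‖ ≤ L * ‖x - y‖) :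
    IsPrim T (fun t => Φ (f t)) (fun t => Φ' (f t) (f' t)) := by
  -- `L` carries no sign condition, so the estimates use `|L|`.
  have hL0 : ∀ x y, ‖Φ' x - Φ' y‖ ≤ |L| * ‖x - y‖ := fun x y =>
    (hL x y).trans (mul_le_mul_of_nonneg_right (le_abs_self L) (norm_nonneg _))
  have hΦ'c : Continuous Φ' := by
    have : LipschitzWith (Real.toNNReal |L|) Φ' := LipschitzWith.of_dist_le_mul fun x y => by
      simpa [dist_eq_norm] using hL0 x y
    exact this.continuous
  have hΦc : Continuous Φ := continuous_iff_continuousAt.2 fun x => (hΦ x).continuousAt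
  have hfc := hf.continuousOn
  have hΦfc : ContinuousOn (fun t => Φ' (f t)) (Icc 0 T) := hΦ'c.comp_continuousOn hfc
  obtain ⟨C, hC0, hC⟩ := exists_norm_le_of_continuousOn_Icc hΦfc
  have hint : Integrable (fun t => Φ' (f t) (f' t)) (timeMeasure T) := by
    refine Integrable.mono' (hf.integrable.norm.const_mul C) ?_ ?_
    · exact (ContinuousLinearMap.id ℝ (X →L[ℝ] Y)).aestronglyMeasurable_comp₂
        (aestronglyMeasurable_of_continuousOn hΦfc) hf.integrable.aestronglyMeasurable
    · filter_upwards [ae_mem_Icc_timeMeasure T] with t ht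
      exact (ContinuousLinearMap.le_opNorm _ _).trans
        (mul_le_mul_of_nonneg_right (hC t ht) (norm_nonneg _))
  refine ⟨hint, fun t ht => ?_⟩
  have hε : ∀ n : ℕ, (0 : ℝ) < 1 / ((n : ℝ) + 1) := fun n => Nat.one_div_pos_of_nat
  -- The classical chain rule holds for the `C¹` curves `F n` with continuous derivatives `g n → f'`
  -- in `L¹`; their uniform distance to `f` is at most the `L¹` distance of the derivatives.
  choose g hgc hgi hg using fun n : ℕ =>
    exists_continuous_integral_norm_sub_le hf.integrable (hε n)
  let F : ℕ → ℝ → X := fun n s => f 0 + ∫ r in (0 : ℝ)..s, g n r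
  have hFd : ∀ n s, HasDerivAt (F n) (g n s) s := fun n s =>
    (intervalIntegral.integral_hasDerivAt_right ((hgc n).intervalIntegrable _ _)
      ((hgc n).stronglyMeasurableAtFilter _ _) (hgc n).continuousAt).const_add _
  have hFc : ∀ n, Continuous (F n) := fun n =>
    continuous_iff_continuousAt.2 fun s => (hFd n s).continuousAt
  have hF0 : ∀ n, F n 0 = f 0 := fun n => by simp [F]
  have hFf : ∀ n, ∀ s ∈ Icc 0 T, ‖F n s - f s‖ ≤ 1 / ((n : ℝ) + 1) := by
    intro n s hs
    have e1 : F n s - f s = ∫ r in (0 : ℝ)..s, (g n r - f' r) := by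
      rw [hf.eq s hs, intervalIntegral.integral_sub
        (intervalIntegrable_of_integrable_timeMeasure (hgi n) hs)
        (intervalIntegrable_of_integrable_timeMeasure hf.integrable hs)]
      simp [F]
    rw [e1]
    exact (norm_intervalIntegral_le_timeMeasure ((hgi n).sub hf.integrable) hs).trans (hg n)
  have hchain : ∀ n, Φ (F n t) = Φ (f 0) + ∫ s in (0 : ℝ)..t, Φ' (F n s) (g n s) := by
    intro n
    have h1 : ∀ s ∈ uIcc 0 t, HasDerivAt (fun s => Φ (F n s)) (Φ' (F n s) (g n s)) s :=
      fun s _ => (hΦ (F n s)).comp_hasDerivAt s (hFd n s)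
    have h2 : Continuous fun s => Φ' (F n s) (g n s) :=
      (hΦ'c.comp (hFc n)).clm_apply (hgc n)
    rw [intervalIntegral.integral_eq_sub_of_hasDerivAt h1 (h2.intervalIntegrable _ _), hF0]
    abel
  have hone : Tendsto (fun n : ℕ => 1 / ((n : ℝ) + 1)) atTop (𝓝 0) :=
    tendsto_one_div_add_atTop_nhds_zero_nat
  have hlim1 : Tendsto (fun n => Φ (F n t)) atTop (𝓝 (Φ (f t))) := by
    refine (hΦc.tendsto _).comp ?_
    rw [tendsto_iff_norm_sub_tendsto_zero]
    exact squeeze_zero (fun _ => norm_nonneg _) (fun n => hFf n t ht) hone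
  have hlim2 : Tendsto (fun n => Φ (f 0) + ∫ s in (0 : ℝ)..t, Φ' (F n s) (g n s)) atTop
      (𝓝 (Φ (f 0) + ∫ s in (0 : ℝ)..t, Φ' (f s) (f' s))) := by
    refine tendsto_const_nhds.add ?_
    rw [tendsto_iff_norm_sub_tendsto_zero]
    set I := ∫ s, ‖f' s‖ ∂(timeMeasure T)
    have hb : ∀ n : ℕ, ‖(∫ s in (0 : ℝ)..t, Φ' (F n s) (g n s))
        - ∫ s in (0 : ℝ)..t, Φ' (f s) (f' s)‖ ≤ (C + |L| + |L| * I) * (1 / ((n : ℝ) + 1)) := by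
      intro n
      have hcont : Continuous fun s => Φ' (F n s) (g n s) :=
        (hΦ'c.comp (hFc n)).clm_apply (hgc n)
      have hi1 : Integrable (fun s => Φ' (F n s) (g n s)) (timeMeasure T) :=
        (hcont.integrableOn_Icc (a := 0) (b := T)).mono_set Ioo_subset_Icc_self
      rw [← intervalIntegral.integral_sub
        (intervalIntegrable_of_integrable_timeMeasure hi1 ht)
        (intervalIntegrable_of_integrable_timeMeasure hint ht)]
      refine (norm_intervalIntegral_le_timeMeasure (hi1.sub hint) ht).trans ?_
      have hgf : Integrable (fun s => ‖g n s - f' s‖) (timeMeasure T) :=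
        ((hgi n).sub hf.integrable).norm
      have hd := hε n
      have hd1 : 1 / ((n : ℝ) + 1) ≤ 1 := by
        rw [div_le_one (by positivity)]; linarith [(n.cast_nonneg : (0 : ℝ) ≤ n)]
      set d := 1 / ((n : ℝ) + 1)
      calc ∫ s, ‖Φ' (F n s) (g n s) - Φ' (f s) (f' s)‖ ∂(timeMeasure T)
          ≤ ∫ s, ((C + |L|) * ‖g n s - f' s‖ + |L| * d * ‖f' s‖) ∂(timeMeasure T) := by
            refine integral_mono_ae (hi1.sub hint).norm
              ((hgf.const_mul _).add (hf.integrable.norm.const_mul _)) ?_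
            filter_upwards [ae_mem_Icc_timeMeasure T] with s hs
            -- The first term is small because `g n → f'` in `L¹`, the second because `F n → f`
            -- uniformly and `Φ'` is Lipschitz.
            have e1 : Φ' (F n s) (g n s) - Φ' (f s) (f' s)
                = Φ' (F n s) (g n s - f' s) + (Φ' (F n s) - Φ' (f s)) (f' s) := by
              simp only [map_sub, sub_apply]; abel
            have e2 : ‖Φ' (F n s) - Φ' (f s)‖ ≤ |L| * d :=
              (hL0 _ _).trans (mul_le_mul_of_nonneg_left (hFf n s hs) (abs_nonneg _))
            have e3 : ‖Φ' (F n s)‖ ≤ C + |L| := by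
              have := norm_add_le (Φ' (f s)) (Φ' (F n s) - Φ' (f s))
              rw [add_sub_cancel] at this
              have h5 : |L| * d ≤ |L| := mul_le_of_le_one_right (abs_nonneg _) hd1
              linarith [hC s hs]
            change ‖Φ' (F n s) (g n s) - Φ' (f s) (f' s)‖ ≤ _
            rw [e1]
            refine (norm_add_le _ _).trans (add_le_add ?_ ?_)
            · exact (ContinuousLinearMap.le_opNorm _ _).trans
                (mul_le_mul_of_nonneg_right e3 (norm_nonneg _))
            · exact (ContinuousLinearMap.le_opNorm _ _).trans
                (mul_le_mul_of_nonneg_right e2 (norm_nonneg _))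
        _ = (C + |L|) * (∫ s, ‖g n s - f' s‖ ∂(timeMeasure T)) + |L| * d * I := by
            rw [integral_add (hgf.const_mul _) (hf.integrable.norm.const_mul _),
              integral_const_mul, integral_const_mul]
        _ ≤ (C + |L|) * d + |L| * d * I := by
            have := mul_le_mul_of_nonneg_left (hg n) (add_nonneg hC0 (abs_nonneg L))
            linarith
        _ = (C + |L| + |L| * I) * d := by ring
    refine squeeze_zero (fun _ => norm_nonneg _) hb ?_
    simpa using hone.const_mul (C + |L| + |L| * I)
  have hlim1' := hlim1.congr hchain
  exact tendsto_nhds_unique hlim1' hlim2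

/-- The product rule for a continuous bilinear map and two primitives. -/
theorem IsPrim.bilin [CompleteSpace X] [CompleteSpace Y] [CompleteSpace Z] {T : ℝ}
    {f f' : ℝ → X} {g g' : ℝ → Y} (hf : IsPrim T f f') (hg : IsPrim T g g')
    (B : X →L[ℝ] Y →L[ℝ] Z) :
    IsPrim T (fun t => B (f t) (g t)) (fun t => B (f t) (g' t) + B (f' t) (g t)) := by
  have hB : ∀ p : X × Y, HasFDerivAt (fun q : X × Y => B q.1 q.2) (B.deriv₂ p) p :=
    fun p => B.isBoundedBilinearMap.hasFDerivAt p
  -- The derivative of a bilinear map is linear in the base point, hence Lipschitz.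
  have := (hf.prodMk hg).chain hB (L := ‖B.deriv₂‖) fun x y => by
    rw [← map_sub]; exact B.deriv₂.le_opNorm _
  simpa using this

theorem IsPrim.inner {E : Type*} [NormedAddCommGroup E] [InnerProductSpace ℝ E] [CompleteSpace E]
    {T : ℝ} {f f' g g' : ℝ → E} (hf : IsPrim T f f') (hg : IsPrim T g g') :
    IsPrim T (fun t => ⟪f t, g t⟫) (fun t => ⟪f t, g' t⟫ + ⟪f' t, g t⟫) :=
  hf.bilin hg (innerSL ℝ)

/-- The primitive of a continuous function is of class `C¹`. -/
theorem IsPrim.hasDerivWithinAt [CompleteSpace X] {T : ℝ} {f f' : ℝ → X} (h : IsPrim T f f')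
    (hc : ContinuousOn f' (Icc 0 T)) {t : ℝ} (ht : t ∈ Icc 0 T) :
    HasDerivWithinAt f (f' t) (Icc 0 T) t := by
  have : Fact (t ∈ Icc 0 T) := ⟨ht⟩
  have h1 : HasDerivWithinAt (fun s => ∫ r in (0 : ℝ)..s, f' r) (f' t) (Icc 0 T) t :=
    intervalIntegral.integral_hasDerivWithinAt_right
      (intervalIntegrable_of_integrable_timeMeasure h.integrable ht)
      ⟨Icc 0 T, self_mem_nhdsWithin, hc.aestronglyMeasurable measurableSet_Icc⟩ (hc t ht)
  exact (h1.const_add (f 0)).congr h.eq (h.eq t ht)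

end TimeCalculus

/-! ### Weak time derivatives and absolutely continuous representatives -/

section WeakDerivative

variable {X : Type*} [NormedAddCommGroup X] [NormedSpace ℝ X] [CompleteSpace X]

theorem isPrim_of_contDiff {φ : ℝ → ℝ} (hφ : ContDiff ℝ ∞ φ) (T : ℝ) :
    IsPrim T φ (deriv φ) := by
  have hc : Continuous (deriv φ) := hφ.continuous_deriv (by simp)
  refine ⟨(hc.integrableOn_Icc (a := 0) (b := T)).mono_set Ioo_subset_Icc_self, fun t _ => ?_⟩
  rw [intervalIntegral.integral_deriv_eq_sub
    (fun s _ => (hφ.differentiable (by simp)).differentiableAt) (hc.intervalIntegrable _ _)]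
  abel

theorem IsPrim.isWeakTimeDeriv {T : ℝ} (hT : 0 < T) {f f' : ℝ → X} (h : IsPrim T f f') :
    IsWeakTimeDeriv T f f' := by
  refine ⟨h.integrable_self, h.integrable, fun φ hφ _ ht => ?_⟩
  have h0 : φ 0 = 0 := image_eq_zero_of_notMem_tsupport fun hm => (ht hm).1.false
  have hTT : φ T = 0 := image_eq_zero_of_notMem_tsupport fun hm => (ht hm).2.false
  have hp := (isPrim_of_contDiff hφ T)
  -- The product rule for `φ • f` at the endpoint `T`; the boundary terms vanish with `φ`.
  have key := (hp.bilin h (ContinuousLinearMap.lsmul ℝ ℝ)).eq T ⟨hT.le, le_rfl⟩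
  simp only [ContinuousLinearMap.lsmul_apply, h0, hTT, zero_smul, zero_add] at key
  rw [intervalIntegral_eq_timeMeasure hT.le, integral_add] at key
  · rw [eq_neg_iff_add_eq_zero, add_comm]; exact key.symm
  · exact integrable_test_smul h.integrable hφ.continuous
  · exact integrable_test_smul h.integrable_self (hφ.continuous_deriv (by simp))

/-- A compactly supported smooth function on `(0, T)` with zero mean is the derivative of a
compactly supported smooth function. -/
theorem exists_test_deriv_eq {T : ℝ} {φ : ℝ → ℝ} (hφ : ContDiff ℝ ∞ φ)
    (hc : HasCompactSupport φ) (hs : tsupport φ ⊆ Ioo 0 T)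
    (h0 : ∫ t in Ioo 0 T, φ t = 0) :
    ∃ ψ : ℝ → ℝ, ContDiff ℝ ∞ ψ ∧ HasCompactSupport ψ ∧ tsupport ψ ⊆ Ioo 0 T ∧ deriv ψ = φ := by
  rcases (tsupport φ).eq_empty_or_nonempty with he | hne
  · rw [tsupport_eq_empty_iff] at he
    exact ⟨0, contDiff_const, HasCompactSupport.zero, by simp, by simp [he]⟩
  obtain ⟨a, ha⟩ := hc.isCompact.exists_isLeast hne
  obtain ⟨b, hb⟩ := hc.isCompact.exists_isGreatest hne
  have ha0 := hs ha.1
  have hb0 := hs hb.1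
  have hz : ∀ t, t ∉ Icc a b → φ t = 0 := fun t ht =>
    image_eq_zero_of_notMem_tsupport fun hm => ht ⟨ha.2 hm, hb.2 hm⟩
  have hd : ∀ t, HasDerivAt (fun s => ∫ r in (0 : ℝ)..s, φ r) (φ t) t := fun t =>
    intervalIntegral.integral_hasDerivAt_right (hφ.continuous.intervalIntegrable _ _)
      (hφ.continuous.stronglyMeasurableAtFilter _ _) hφ.continuous.continuousAt
  have hderiv : deriv (fun s => ∫ r in (0 : ℝ)..s, φ r) = φ := funext fun t => (hd t).deriv
  have hzero : ∀ t, t ∉ Icc a b → ∫ r in (0 : ℝ)..t, φ r = 0 := by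
    intro t ht
    -- Left of the support the integrand vanishes; right of it the zero mean is needed.
    rcases lt_or_ge t a with h | h
    · refine intervalIntegral.integral_zero_ae (Eventually.of_forall fun r hr => hz r fun hr' => ?_)
      have : r ≤ max 0 t := hr.2
      have : max 0 t < a := max_lt ha0.1 h
      linarith [hr'.1]
    · have htb : b < t := not_le.1 fun h' => ht ⟨h, h'⟩
      have e1 : ∫ r in (0 : ℝ)..T, φ r = 0 := by
        rw [intervalIntegral_eq_timeMeasure (ha0.1.trans ha0.2).le]; exact h0
      have e2 : ∫ r in t..T, φ r = 0 := by
        refine intervalIntegral.integral_zero_ae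
          (Eventually.of_forall fun r hr => hz r fun hr' => ?_)
        have : min t T < r := hr.1
        have : b < min t T := lt_min htb hb0.2
        linarith [hr'.2]
      have e3 := intervalIntegral.integral_add_adjacent_intervals
        (hφ.continuous.intervalIntegrable (μ := volume) 0 t)
        (hφ.continuous.intervalIntegrable (μ := volume) t T)
      rw [e2, e1, add_zero] at e3
      exact e3
  have hsub : tsupport (fun s => ∫ r in (0 : ℝ)..s, φ r) ⊆ Icc a b :=
    closure_minimal (fun t ht => by_contra fun h => ht (hzero t h)) isClosed_Icc
  refine ⟨fun s => ∫ r in (0 : ℝ)..s, φ r, ?_, ?_, ?_, hderiv⟩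
  · rw [contDiff_infty_iff_deriv]
    exact ⟨fun t => (hd t).differentiableAt, by rw [hderiv]; exact hφ⟩
  · exact HasCompactSupport.of_support_subset_isCompact isCompact_Icc (subset_closure.trans hsub)
  · exact hsub.trans fun t ht => ⟨ha0.1.trans_le ht.1, ht.2.trans_lt hb0.2⟩

theorem exists_test_integral_eq_one {T : ℝ} (hT : 0 < T) :
    ∃ ρ : ℝ → ℝ, ContDiff ℝ ∞ ρ ∧ HasCompactSupport ρ ∧ tsupport ρ ⊆ Ioo 0 T ∧
      ∫ t in Ioo 0 T, ρ t = 1 := by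
  let B : ContDiffBump (T / 2) := ⟨T / 8, T / 4, by positivity, by linarith⟩
  have hs : tsupport (B.normed volume) ⊆ Ioo 0 T := by
    rw [B.tsupport_normed_eq, Real.closedBall_eq_Icc]
    intro t ht
    have h1 : T / 2 - T / 4 ≤ t := ht.1
    have h2 : t ≤ T / 2 + T / 4 := ht.2
    constructor <;> linarith
  refine ⟨B.normed volume, B.contDiff_normed, B.hasCompactSupport_normed, hs, ?_⟩
  rw [setIntegral_eq_integral_of_forall_compl_eq_zero, B.integral_normed]
  exact fun t ht => image_eq_zero_of_notMem_tsupport fun hm => ht (hs hm)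

/-- A function with a vanishing weak derivative is constant. -/
theorem IsWeakTimeDeriv.ae_eq_const {T : ℝ} (hT : 0 < T) {f : ℝ → X}
    (h : IsWeakTimeDeriv T f fun _ => 0) : ∃ c : X, f =ᵐ[timeMeasure T] fun _ => c := by
  obtain ⟨hf, -, hw⟩ := h
  obtain ⟨ρ, hρ, hρc, hρs, hρ1⟩ := exists_test_integral_eq_one hT
  -- The constant is the mean of `f` weighted by `ρ`. Any test function `φ` differs from `m ρ`, with
  -- `m` its integral, by a function of zero mean, which is the derivative of a test function and so
  -- is annihilated by `f`.
  refine ⟨∫ t in Ioo 0 T, ρ t • f t, ?_⟩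
  set c := ∫ t in Ioo 0 T, ρ t • f t
  have hfc : Integrable (fun t => f t - c) (timeMeasure T) := hf.sub (integrable_const c)
  have key := isOpen_Ioo.ae_eq_zero_of_integral_contDiff_smul_eq_zero
    (f := fun t => f t - c) (μ := volume) (U := Ioo 0 T)
    (IntegrableOn.locallyIntegrableOn hfc) fun φ hφ hφc hφs => by
      rw [← setIntegral_eq_integral_of_forall_compl_eq_zero (s := Ioo 0 T) fun t ht => by
        rw [image_eq_zero_of_notMem_tsupport fun hm => ht (hφs hm), zero_smul]]
      have hφi : Integrable φ (timeMeasure T) :=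
        (hφ.continuous.integrableOn_Icc (a := 0) (b := T)).mono_set Ioo_subset_Icc_self
      have hρi : Integrable ρ (timeMeasure T) :=
        (hρ.continuous.integrableOn_Icc (a := 0) (b := T)).mono_set Ioo_subset_Icc_self
      set m := ∫ t in Ioo 0 T, φ t
      have hsupp : tsupport (fun t => φ t - m * ρ t) ⊆ Ioo 0 T :=
        (tsupport_sub φ (fun t => m * ρ t)).trans
          (union_subset hφs ((tsupport_mul_subset_right).trans hρs))
      obtain ⟨ψ, hψ, hψc, hψs, hψd⟩ := exists_test_deriv_eq
        (φ := fun t => φ t - m * ρ t) (T := T) (hφ.sub (contDiff_const.mul hρ))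
        (hφc.sub hρc.mul_left) hsupp (by
          rw [integral_sub hφi (hρi.const_mul m), integral_const_mul, hρ1, mul_one, sub_self])
      have h1 := hw ψ hψ hψc hψs
      simp only [smul_zero, integral_zero, neg_zero, hψd] at h1
      simp only [sub_smul, mul_smul] at h1
      rw [integral_sub (integrable_test_smul hf hφ.continuous)
        (show Integrable (fun t => m • ρ t • f t) (timeMeasure T) from
          (integrable_test_smul hf hρ.continuous).smul m), integral_smul, sub_eq_zero] at h1
      simp only [smul_sub]
      rw [integral_sub (integrable_test_smul hf hφ.continuous)
        (integrable_test_smul (integrable_const c) hφ.continuous), h1, integral_smul_const,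
        sub_self]
  filter_upwards [(ae_restrict_iff' measurableSet_Ioo).2 key] with t ht using sub_eq_zero.1 ht

theorem IsWeakTimeDeriv.sub {T : ℝ} {f f' g g' : ℝ → X} (hf : IsWeakTimeDeriv T f f')
    (hg : IsWeakTimeDeriv T g g') :
    IsWeakTimeDeriv T (fun t => f t - g t) (fun t => f' t - g' t) := by
  refine ⟨hf.1.sub hg.1, hf.2.1.sub hg.2.1, fun φ hφ hc hs => ?_⟩
  have hd : Continuous (deriv φ) := hφ.continuous_deriv (by simp)
  simp only [smul_sub]
  rw [integral_sub (integrable_test_smul hf.1 hd) (integrable_test_smul hg.1 hd),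
    integral_sub (integrable_test_smul hf.2.1 hφ.continuous)
      (integrable_test_smul hg.2.1 hφ.continuous), hf.2.2 φ hφ hc hs, hg.2.2 φ hφ hc hs]
  abel

theorem IsWeakTimeDeriv.congr {T : ℝ} {f f' g g' : ℝ → X} (h : IsWeakTimeDeriv T f f')
    (hf : f =ᵐ[timeMeasure T] g) (hf' : f' =ᵐ[timeMeasure T] g') : IsWeakTimeDeriv T g g' := by
  refine ⟨h.1.congr hf, h.2.1.congr hf', fun φ hφ hc hs => ?_⟩
  rw [← integral_congr_ae (hf.mono fun t ht => by simp only [ht] :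
      (fun t => deriv φ t • f t) =ᵐ[timeMeasure T] fun t => deriv φ t • g t),
    ← integral_congr_ae (hf'.mono fun t ht => by simp only [ht] :
      (fun t => φ t • f' t) =ᵐ[timeMeasure T] fun t => φ t • g' t)]
  exact h.2.2 φ hφ hc hs

/-- A weakly differentiable function has an absolutely continuous representative. -/
theorem IsWeakTimeDeriv.exists_isPrim {T : ℝ} (hT : 0 < T) {f f' : ℝ → X}
    (h : IsWeakTimeDeriv T f f') :
    ∃ g : ℝ → X, IsPrim T g f' ∧ f =ᵐ[timeMeasure T] g := by
  -- Subtracting a primitive of `f'` leaves a function with vanishing weak derivative.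
  have hp := (IsPrim.of_integrable h.2.1 (0 : X))
  obtain ⟨c, hc⟩ := ((h.sub (hp.isWeakTimeDeriv hT)).congr EventuallyEq.rfl
    (Eventually.of_forall fun t => sub_self _)).ae_eq_const hT
  refine ⟨_, IsPrim.of_integrable h.2.1 c, hc.mono fun t ht => ?_⟩
  simp only [zero_add] at ht
  simp only [← ht, sub_add_cancel]

end WeakDerivative

/-! ### The regularizing resolvent of `ι* ι` -/

section Resolvent

variable {W K : Type*} [NormedAddCommGroup W] [InnerProductSpace ℝ W] [CompleteSpace W]
  [NormedAddCommGroup K] [InnerProductSpace ℝ K] [CompleteSpace K]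

/-- `Q` is the resolvent `(ι* ι + ε)⁻¹`. -/
structure IsResolvent (ι : W →L[ℝ] K) (ε : ℝ) (Q : W →L[ℝ] W) : Prop where
  right : ∀ v, ι.adjoint (ι (Q v)) + ε • Q v = v
  left : ∀ v, Q (ι.adjoint (ι v)) + ε • Q v = v

/-- Lax–Milgram: the form `⟪ι v, ι w⟫ + ε ⟪v, w⟫` is coercive with constant `ε`. -/
theorem exists_isResolvent (ι : W →L[ℝ] K) {ε : ℝ} (hε : 0 < ε) :
    ∃ Q : W →L[ℝ] W, IsResolvent ι ε Q := by
  let A : W →L[ℝ] W := ι.adjoint.comp ι + ε • ContinuousLinearMap.id ℝ W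
  have hA : ∀ v, A v = ι.adjoint (ι v) + ε • v := fun v => rfl
  let B : W →L[ℝ] W →L[ℝ] ℝ := (innerSL ℝ).comp A
  have hB : ∀ v w, B v w = ⟪A v, w⟫ := fun v w => rfl
  have hco : IsCoercive B := ⟨ε, hε, fun v => by
    rw [hB, hA, inner_add_left, ContinuousLinearMap.adjoint_inner_left, real_inner_smul_left,
      real_inner_self_eq_norm_mul_norm, real_inner_self_eq_norm_mul_norm]
    nlinarith [mul_self_nonneg ‖ι v‖]⟩
  have hE : ∀ v, hco.continuousLinearEquivOfBilin v = A v := fun v =>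
    (hco.unique_continuousLinearEquivOfBilin fun w => (hB v w).symm).symm
  refine ⟨hco.continuousLinearEquivOfBilin.symm, fun v => ?_, fun v => ?_⟩
  · rw [ContinuousLinearEquiv.coe_coe, ← hA, ← hE, ContinuousLinearEquiv.apply_symm_apply]
  · rw [← map_smul, ← map_add, ← hA, ← hE]
    exact ContinuousLinearEquiv.symm_apply_apply _ v

namespace IsResolvent

variable {ι : W →L[ℝ] K} {ε : ℝ} {Q : W →L[ℝ] W}

/-- Both sides equal `v - ε Q v`. This is the only property of `Q` that the energy identity uses. -/
theorem comm (h : IsResolvent ι ε Q) (v : W) : Q (ι.adjoint (ι v)) = ι.adjoint (ι (Q v)) :=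
  add_right_cancel ((h.left v).trans (h.right v).symm)

theorem norm_smul_le (h : IsResolvent ι ε Q) (v : W) : ε * ‖Q v‖ ≤ ‖v‖ := by
  have h1 : ‖ι (Q v)‖ * ‖ι (Q v)‖ + ε * (‖Q v‖ * ‖Q v‖) = ⟪v, Q v⟫ := by
    rw [← real_inner_self_eq_norm_mul_norm, ← real_inner_self_eq_norm_mul_norm,
      ← real_inner_smul_left, ← ContinuousLinearMap.adjoint_inner_left, ← inner_add_left, h.right]
  have h2 := real_inner_le_norm v (Q v)
  rcases (norm_nonneg (Q v)).eq_or_lt with h0 | h0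
  · rw [← h0, mul_zero]; exact norm_nonneg v
  · refine le_of_mul_le_mul_right ?_ h0
    nlinarith [mul_self_nonneg ‖ι (Q v)‖]

/-- Testing the resolvent equation for `q = Q ι* k` with `q` itself gives `‖ι q‖² + ε ‖q‖² = ⟪k, ι
q⟫`. The bound does not depend on `ε`. -/
theorem norm_pivot_le (h : IsResolvent ι ε Q) (hε : 0 < ε) (k : K) :
    ‖ι (Q (ι.adjoint k))‖ ≤ ‖k‖ := by
  set q := Q (ι.adjoint k) with hq
  have h1 : ‖ι q‖ * ‖ι q‖ + ε * (‖q‖ * ‖q‖) = ⟪k, ι q⟫ := by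
    rw [← ContinuousLinearMap.adjoint_inner_left, ← h.right (ι.adjoint k), ← hq, inner_add_left,
      ContinuousLinearMap.adjoint_inner_left, real_inner_smul_left,
      real_inner_self_eq_norm_mul_norm, real_inner_self_eq_norm_mul_norm]
  have h2 := real_inner_le_norm k (ι q)
  rcases (norm_nonneg (ι q)).eq_or_lt with h0 | h0
  · rw [← h0]; exact norm_nonneg k
  · refine le_of_mul_le_mul_right ?_ h0
    nlinarith [mul_self_nonneg ‖q‖, mul_nonneg hε.le (mul_self_nonneg ‖q‖)]

theorem norm_sub_le (h : IsResolvent ι ε Q) (hε : 0 < ε) (v : W) :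
    ‖Q (ι.adjoint (ι v)) - v‖ ≤ ‖v‖ := by
  have : Q (ι.adjoint (ι v)) - v = -(ε • Q v) := by
    rw [sub_eq_iff_eq_add, neg_add_eq_sub, eq_sub_iff_add_eq, h.left]
  rw [this, norm_neg, norm_smul, Real.norm_of_nonneg hε.le]
  exact h.norm_smul_le v

/-- The error of the approximation at `v` is `-ε Q v`. For `v = ι* ι z` the vector `Q v` is bounded
by `2 ‖z‖`, uniformly in `ε`, so on this range the error is of order `ε`. -/
theorem norm_sub_range_le (h : IsResolvent ι ε Q) (hε : 0 < ε) (z : W) :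
    ‖Q (ι.adjoint (ι (ι.adjoint (ι z)))) - ι.adjoint (ι z)‖ ≤ ε * (2 * ‖z‖) := by
  have e1 : Q (ι.adjoint (ι (ι.adjoint (ι z)))) - ι.adjoint (ι z)
      = -(ε • Q (ι.adjoint (ι z))) := by
    rw [sub_eq_iff_eq_add, neg_add_eq_sub, eq_sub_iff_add_eq, h.left]
  rw [e1, norm_neg, norm_smul, Real.norm_of_nonneg hε.le]
  refine mul_le_mul_of_nonneg_left ?_ hε.le
  have h2 := norm_add_le (Q (ι.adjoint (ι z)) - z) z
  rw [sub_add_cancel] at h2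
  linarith [h.norm_sub_le hε z]

end IsResolvent

/-- A uniform Lipschitz bound carries pointwise convergence from a dense set to the whole space. -/
theorem tendsto_zero_of_denseRange {α E F : Type*} [NormedAddCommGroup E] [NormedAddCommGroup F]
    {A : ℕ → E → F} {C : ℝ} (hC : 0 ≤ C)
    (hA : ∀ n v w, ‖A n v - A n w‖ ≤ C * ‖v - w‖) {g : α → E}
    (hg : DenseRange g) (h : ∀ a, Tendsto (fun n => A n (g a)) atTop (𝓝 0)) (v : E) :
    Tendsto (fun n => A n v) atTop (𝓝 0) := by
  rw [Metric.tendsto_atTop]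
  intro ε hε
  obtain ⟨a, ha⟩ := hg.exists_dist_lt v (show 0 < ε / (2 * (C + 1)) by positivity)
  obtain ⟨N, hN⟩ := Metric.tendsto_atTop.1 (h a) (ε / 2) (by positivity)
  refine ⟨N, fun n hn => ?_⟩
  have h1 := hN n hn
  rw [dist_zero_right] at h1 ⊢
  rw [dist_eq_norm, lt_div_iff₀ (by positivity)] at ha
  have h2 := hA n v (g a)
  have h3 := norm_add_le (A n v - A n (g a)) (A n (g a))
  rw [sub_add_cancel] at h3
  nlinarith [norm_nonneg (v - g a)]

/-- The range of `ι* ι` is dense if `ι` is injective. -/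
theorem denseRange_adjoint_comp {ι : W →L[ℝ] K} (hι : Function.Injective ι) :
    DenseRange fun v => ι.adjoint (ι v) := by
  have : Dense ((ι.adjoint.comp ι).range : Set W) := by
    rw [Submodule.dense_iff_topologicalClosure_eq_top, Submodule.topologicalClosure_eq_top_iff,
      Submodule.eq_bot_iff]
    intro v hv
    have h1 : ⟪ι.adjoint (ι v), v⟫ = 0 := hv _ ⟨v, rfl⟩
    rw [ContinuousLinearMap.adjoint_inner_left, inner_self_eq_zero] at h1
    exact hι (h1.trans (map_zero ι).symm)
  exact this

theorem tendsto_resolvent {ι : W →L[ℝ] K} (hι : Function.Injective ι) {ε : ℕ → ℝ}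
    (hε : ∀ n, 0 < ε n) (hε0 : Tendsto ε atTop (𝓝 0)) {Q : ℕ → W →L[ℝ] W}
    (hQ : ∀ n, IsResolvent ι (ε n) (Q n)) (v : W) :
    Tendsto (fun n => Q n (ι.adjoint (ι v))) atTop (𝓝 v) := by
  rw [← tendsto_sub_nhds_zero_iff]
  refine tendsto_zero_of_denseRange (A := fun n v => Q n (ι.adjoint (ι v)) - v) zero_le_one
    (fun n v w => ?_) (denseRange_adjoint_comp hι) (fun z => ?_) v
  · have : Q n (ι.adjoint (ι v)) - v - (Q n (ι.adjoint (ι w)) - w)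
        = Q n (ι.adjoint (ι (v - w))) - (v - w) := by simp only [map_sub]; abel
    rw [this, one_mul]
    exact (hQ n).norm_sub_le (hε n) _
  · refine squeeze_zero_norm (fun n => (hQ n).norm_sub_range_le (hε n) z) ?_
    simpa using hε0.mul_const (2 * ‖z‖)

/-- On the range of `ι` this is the convergence in `W`; density and the uniform bound in `K` do the
rest. -/
theorem tendsto_resolvent_pivot {ι : W →L[ℝ] K} (hι : Function.Injective ι) (hd : DenseRange ι)
    {ε : ℕ → ℝ} (hε : ∀ n, 0 < ε n) (hε0 : Tendsto ε atTop (𝓝 0)) {Q : ℕ → W →L[ℝ] W}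
    (hQ : ∀ n, IsResolvent ι (ε n) (Q n)) (k : K) :
    Tendsto (fun n => ι (Q n (ι.adjoint k))) atTop (𝓝 k) := by
  rw [← tendsto_sub_nhds_zero_iff]
  refine tendsto_zero_of_denseRange (A := fun n k => ι (Q n (ι.adjoint k)) - k) zero_le_two
    (fun n v w => ?_) hd (fun z => ?_) k
  · have : ι (Q n (ι.adjoint v)) - v - (ι (Q n (ι.adjoint w)) - w)
        = ι (Q n (ι.adjoint (v - w))) - (v - w) := by simp only [map_sub]; abel
    rw [this]
    refine (_root_.norm_sub_le _ _).trans ?_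
    linarith [(hQ n).norm_pivot_le (hε n) (v - w)]
  · rw [tendsto_sub_nhds_zero_iff]
    exact (ι.continuous.tendsto z).comp (tendsto_resolvent hι hε hε0 hQ z)

end Resolvent

/-! ### Energy identity and estimate for regularized waves -/

section Energy

variable {W K : Type*} [NormedAddCommGroup W] [InnerProductSpace ℝ W] [CompleteSpace W]
  [NormedAddCommGroup K] [InnerProductSpace ℝ K] [CompleteSpace K]

theorem IsPrim.const_mul {T : ℝ} {f f' : ℝ → ℝ} (h : IsPrim T f f') (c : ℝ) :
    IsPrim T (fun t => c * f t) (fun t => c * f' t) :=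
  h.clm (ContinuousLinearMap.lsmul ℝ ℝ c)

theorem IsPrim.sub {X : Type*} [NormedAddCommGroup X] [NormedSpace ℝ X] {T : ℝ}
    {f f' g g' : ℝ → X} (hf : IsPrim T f f') (hg : IsPrim T g g') :
    IsPrim T (fun t => f t - g t) (fun t => f' t - g' t) :=
  ⟨hf.integrable.sub hg.integrable, fun t ht => by
    rw [hf.eq t ht, hg.eq t ht, intervalIntegral.integral_sub
      (intervalIntegrable_of_integrable_timeMeasure hf.integrable ht)
      (intervalIntegrable_of_integrable_timeMeasure hg.integrable ht)]
    abel⟩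

/-- Primitives are stable under dominated convergence. -/
theorem IsPrim.of_tendsto {X : Type*} [NormedAddCommGroup X] [NormedSpace ℝ X] {T : ℝ}
    {f f' : ℕ → ℝ → X} {g g' : ℝ → X} (h : ∀ n, IsPrim T (f n) (f' n)) {bound : ℝ → ℝ}
    (hb : Integrable bound (timeMeasure T)) (hfb : ∀ n, ∀ᵐ t ∂(timeMeasure T), ‖f' n t‖ ≤ bound t)
    (hf : ∀ t ∈ Icc 0 T, Tendsto (fun n => f n t) atTop (𝓝 (g t)))
    (hf' : ∀ᵐ t ∂(timeMeasure T), Tendsto (fun n => f' n t) atTop (𝓝 (g' t))) :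
    IsPrim T g g' := by
  have hm : ∀ n, AEStronglyMeasurable (f' n) (timeMeasure T) := fun n =>
    (h n).integrable.aestronglyMeasurable
  refine ⟨?_, fun t ht => ?_⟩
  · refine hb.mono' (aestronglyMeasurable_of_tendsto_ae atTop hm hf') ?_
    filter_upwards [hf', ae_all_iff.2 hfb] with t h1 h2
    exact le_of_tendsto h1.norm (Eventually.of_forall h2)
  · have h0 : (0 : ℝ) ∈ Icc 0 T := ⟨le_rfl, ht.1.trans ht.2⟩
    have hle : volume.restrict (Ioc 0 t) ≤ volume.restrict (Ioc 0 T) :=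
      Measure.restrict_mono (Ioc_subset_Ioc_right ht.2) le_rfl
    have hIoc : timeMeasure T = volume.restrict (Ioc 0 T) :=
      (restrict_Ioo_eq_restrict_Ioc)
    rw [hIoc] at hb hfb hf' hm
    refine tendsto_nhds_unique ((hf t ht).congr fun n => (h n).eq t ht) ((hf 0 h0).add ?_)
    simp only [intervalIntegral.integral_of_le ht.1]
    exact tendsto_integral_of_dominated_convergence bound (fun n => (hm n).mono_measure hle)
      (hb.mono_measure hle) (fun n => ae_mono hle (hfb n)) (ae_mono hle hf')

/-- Data for the abstract wave equation `(ι* ι u)'' + κ u = ι* F₁ + F₂` in `W`. -/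
structure IsWave (T κ : ℝ) (ι : W →L[ℝ] K) (u y z f2 : ℝ → W) (F1 : ℝ → K) (F2 F2' : ℝ → W)
    (u0 : W) (u0' : K) : Prop where
  prim_y : IsPrim T y z
  prim_z : IsPrim T z f2
  y_eq : ∀ᵐ t ∂(timeMeasure T), y t = ι.adjoint (ι (u t))
  y_zero : y 0 = ι.adjoint (ι u0)
  z_zero : z 0 = ι.adjoint u0'
  integrable_F1 : Integrable F1 (timeMeasure T)
  prim_F2 : IsPrim T F2 F2'
  eqn : ∀ᵐ t ∂(timeMeasure T), f2 t + κ • u t = ι.adjoint (F1 t) + F2 t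

namespace IsWave

variable {T κ : ℝ} {ι : W →L[ℝ] K} {u y z f2 : ℝ → W} {F1 : ℝ → K} {F2 F2' : ℝ → W}
  {u0 : W} {u0' : K}

/-- The energy identity for a regularized solution. -/
theorem isPrim_energy (h : IsWave T κ ι u y z f2 F1 F2 F2' u0 u0') (Q : W →L[ℝ] W)
    (hQ : ∀ v, Q (ι.adjoint (ι v)) = ι.adjoint (ι (Q v))) :
    IsPrim T
      (fun t => ‖ι (Q (z t))‖ ^ 2 + κ * ‖Q (y t)‖ ^ 2
        - 2 * ⟪Q (ι.adjoint (ι (F2 t))), Q (y t)⟫)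
      (fun t => 2 * ⟪ι (Q (ι.adjoint (F1 t))), ι (Q (z t))⟫
        - 2 * ⟪Q (ι.adjoint (ι (F2' t))), Q (y t)⟫) := by
  have hw := h.prim_y.clm Q
  have hz := h.prim_z.clm (ι.comp Q)
  have hF := h.prim_F2.clm (Q.comp (ι.adjoint.comp ι))
  have key := ((hz.inner hz).add ((hw.inner hw).const_mul κ)).sub ((hF.inner hw).const_mul 2)
  simp only [ContinuousLinearMap.comp_apply, real_inner_self_eq_norm_sq] at key
  refine key.congr_deriv ?_
  filter_upwards [h.y_eq, h.eqn] with t hy he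
  have e1 : f2 t = ι.adjoint (F1 t) + F2 t - κ • u t := by rw [← he, add_sub_cancel_right]
  -- By commutation `⟪ι Q u, ι Q z⟫ = ⟪Q y, Q z⟫`, so the elastic term cancels the derivative of `κ
  -- ‖Q y‖²`. In the same way the work of `F2` cancels against the product rule for the third energy
  -- term, leaving only `F2'` paired with `Q y`.
  have e2 : ⟪ι (Q (f2 t)), ι (Q (z t))⟫ = ⟪ι (Q (ι.adjoint (F1 t))), ι (Q (z t))⟫
      + ⟪Q (ι.adjoint (ι (F2 t))), Q (z t)⟫ - κ * ⟪Q (y t), Q (z t)⟫ := by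
    rw [e1, hy, hQ, hQ, ContinuousLinearMap.adjoint_inner_left,
      ContinuousLinearMap.adjoint_inner_left]
    simp only [map_sub, map_add, map_smul, inner_sub_left, inner_add_left, real_inner_smul_left]
  rw [real_inner_comm (ι (Q (f2 t))) (ι (Q (z t))), real_inner_comm (Q (z t)) (Q (y t)), e2,
    real_inner_comm (Q (y t)) (Q (z t))]
  ring

/-- The bookkeeping of constants: `6 = 2 + 2 + 2` collects the `F2` terms at the final time, at time
zero and under the time integral. -/
theorem energy_le_of_eq {A I B J S J0 a c M K1 K2 s : ℝ} (h : A - 2 * I = S + B - 2 * J + J0)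
    (hI : I ≤ K2 * (s * M)) (hJ : -(K2 * (s * M)) ≤ J)
    (hJ0 : J0 ≤ 2 * M * K1 + 2 * (s * M) * K2) (hS : S ≤ a * M) (hB : B ≤ c * M) :
    A ≤ (a + c + 2 * K1 + 6 * s * K2) * M := by
  linarith

/-- The energy estimate for a regularized solution. -/
theorem norm_le (hκ : 0 < κ) (hT : 0 < T) (h : IsWave T κ ι u y z f2 F1 F2 F2' u0 u0')
    (Q : W →L[ℝ] W) (hQ : ∀ v, Q (ι.adjoint (ι v)) = ι.adjoint (ι (Q v))) {R : ℝ}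
    (hR : ‖ι (Q (ι.adjoint u0'))‖ + √κ * ‖Q (ι.adjoint (ι u0))‖
      + 2 * (∫ s, ‖ι (Q (ι.adjoint (F1 s)))‖ ∂(timeMeasure T))
      + 6 * (√κ)⁻¹ * (‖Q (ι.adjoint (ι (F2 0)))‖
        + ∫ s, ‖Q (ι.adjoint (ι (F2' s)))‖ ∂(timeMeasure T)) ≤ R) :
    ∀ t ∈ Icc 0 T, ‖ι (Q (z t))‖ ≤ R ∧ ‖Q (y t)‖ ≤ (√κ)⁻¹ * R := by
  have hsκ : 0 < √κ := Real.sqrt_pos.2 hκ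
  have hsq : √κ * √κ = κ := Real.mul_self_sqrt hκ.le
  set s := (√κ)⁻¹ with hs
  have hs0 : 0 < s := inv_pos.2 hsκ
  have hss : s * √κ = 1 := inv_mul_cancel₀ hsκ.ne'
  have hwc : ContinuousOn (fun t => Q (y t)) (Icc 0 T) := (h.prim_y.clm Q).continuousOn
  have hzc : ContinuousOn (fun t => ι (Q (z t))) (Icc 0 T) :=
    (h.prim_z.clm (ι.comp Q)).continuousOn
  have hF := h.prim_F2.clm (Q.comp (ι.adjoint.comp ι))
  have hF1 : Integrable (fun t => ι (Q (ι.adjoint (F1 t)))) (timeMeasure T) :=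
    (ι.comp (Q.comp ι.adjoint)).integrable_comp h.integrable_F1
  have hF2 : Integrable (fun t => ‖Q (ι.adjoint (ι (F2' t)))‖) (timeMeasure T) :=
    hF.integrable.norm
  have hE : ContinuousOn (fun t => ‖ι (Q (z t))‖ ^ 2 + κ * ‖Q (y t)‖ ^ 2) (Icc 0 T) :=
    (hzc.norm.pow 2).add ((hwc.norm.pow 2).const_smul κ)
  -- At a maximum point of the energy, with value `M²`, every term of the identity is at most a
  -- constant of the data times `M`; dividing by `M` gives a bound linear in the data, with no
  -- Gronwall argument.
  obtain ⟨t0, ht0, hmax⟩ := isCompact_Icc.exists_isMaxOn ⟨0, le_rfl, hT.le⟩ hE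
  set M2 := ‖ι (Q (z t0))‖ ^ 2 + κ * ‖Q (y t0)‖ ^ 2 with hM2
  have hM20 : 0 ≤ M2 := by positivity
  set M := √M2 with hM
  have hM0 : 0 ≤ M := Real.sqrt_nonneg _
  have hMM : M * M = M2 := Real.mul_self_sqrt hM20
  have hle : ∀ t ∈ Icc 0 T, ‖ι (Q (z t))‖ ≤ M ∧ ‖Q (y t)‖ ≤ s * M := by
    intro t ht
    have h1 : ‖ι (Q (z t))‖ ^ 2 + κ * ‖Q (y t)‖ ^ 2 ≤ M2 := hmax ht
    constructor
    · refine Real.le_sqrt_of_sq_le ?_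
      have : 0 ≤ κ * ‖Q (y t)‖ ^ 2 := by positivity
      linarith
    · have h2 : √κ * ‖Q (y t)‖ ≤ M := by
        refine Real.le_sqrt_of_sq_le ?_
        rw [mul_pow, pow_two (√κ), hsq]
        linarith [sq_nonneg ‖ι (Q (z t))‖]
      calc ‖Q (y t)‖ = s * (√κ * ‖Q (y t)‖) := by rw [← mul_assoc, hss, one_mul]
        _ ≤ s * M := mul_le_mul_of_nonneg_left h2 hs0.le
  set K1 := ∫ s, ‖ι (Q (ι.adjoint (F1 s)))‖ ∂(timeMeasure T) with hK1
  set K2 := ‖Q (ι.adjoint (ι (F2 0)))‖ + ∫ s, ‖Q (ι.adjoint (ι (F2' s)))‖ ∂(timeMeasure T)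
    with hK2
  have hI0 : 0 ≤ ∫ s, ‖Q (ι.adjoint (ι (F2' s)))‖ ∂(timeMeasure T) :=
    integral_nonneg fun _ => norm_nonneg _
  have h00 : (0 : ℝ) ∈ Icc 0 T := ⟨le_rfl, hT.le⟩
  have hFle : ∀ t ∈ Icc 0 T, ‖Q (ι.adjoint (ι (F2 t)))‖ ≤ K2 := by
    intro t ht
    have e := hF.eq t ht
    simp only [ContinuousLinearMap.comp_apply] at e
    rw [e]
    exact (norm_add_le _ _).trans
      (add_le_add le_rfl (norm_intervalIntegral_le_timeMeasure hF.integrable ht))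
  have hinner : ∀ t ∈ Icc 0 T, |⟪Q (ι.adjoint (ι (F2 t))), Q (y t)⟫| ≤ K2 * (s * M) :=
    fun t ht => (abs_real_inner_le_norm _ _).trans
      (mul_le_mul (hFle t ht) (hle t ht).2 (norm_nonneg _)
        ((norm_nonneg _).trans (hFle t ht)))
  have hP := h.isPrim_energy Q hQ
  have hint : ‖∫ r in (0 : ℝ)..t0, (2 * ⟪ι (Q (ι.adjoint (F1 r))), ι (Q (z r))⟫
        - 2 * ⟪Q (ι.adjoint (ι (F2' r))), Q (y r)⟫)‖ ≤ 2 * M * K1 + 2 * (s * M) * K2 := by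
    refine (norm_intervalIntegral_le_timeMeasure hP.integrable ht0).trans ?_
    calc _ ≤ ∫ r, (2 * M * ‖ι (Q (ι.adjoint (F1 r)))‖
          + 2 * (s * M) * ‖Q (ι.adjoint (ι (F2' r)))‖) ∂(timeMeasure T) := by
          refine integral_mono_ae hP.integrable.norm
            ((hF1.norm.const_mul _).add (hF2.const_mul _)) ?_
          filter_upwards [ae_mem_Icc_timeMeasure T] with r hr
          refine (_root_.norm_sub_le _ _).trans (add_le_add ?_ ?_)
          · rw [norm_mul, Real.norm_two, mul_assoc]
            refine mul_le_mul_of_nonneg_left ?_ zero_le_two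
            refine (abs_real_inner_le_norm _ _).trans ?_
            rw [mul_comm]
            exact mul_le_mul_of_nonneg_right (hle r hr).1 (norm_nonneg _)
          · rw [norm_mul, Real.norm_two, mul_assoc]
            refine mul_le_mul_of_nonneg_left ?_ zero_le_two
            refine (abs_real_inner_le_norm _ _).trans ?_
            rw [mul_comm]
            exact mul_le_mul_of_nonneg_right (hle r hr).2 (norm_nonneg _)
      _ = 2 * M * K1 + 2 * (s * M) * ∫ s, ‖Q (ι.adjoint (ι (F2' s)))‖ ∂(timeMeasure T) := by
          rw [integral_add (hF1.norm.const_mul _) (hF2.const_mul _),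
            integral_const_mul, integral_const_mul]
      _ ≤ _ := by
          refine add_le_add le_rfl (mul_le_mul_of_nonneg_left ?_ (by positivity))
          rw [hK2]; linarith [norm_nonneg (Q (ι.adjoint (ι (F2 0))))]
  have e0 := hP.eq t0 ht0
  have hz0 : ι (Q (z 0)) = ι (Q (ι.adjoint u0')) := by rw [h.z_zero]
  have hy0 : Q (y 0) = Q (ι.adjoint (ι u0)) := by rw [h.y_zero]
  set a0 := ‖ι (Q (ι.adjoint u0'))‖ with ha0
  set c0 := ‖Q (ι.adjoint (ι u0))‖ with hc0
  have ha0M : a0 ≤ M := by rw [ha0, ← hz0]; exact (hle 0 h00).1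
  have hc0M : √κ * c0 ≤ M := by
    have := (hle 0 h00).2
    rw [hy0] at this
    calc √κ * c0 ≤ √κ * (s * M) := mul_le_mul_of_nonneg_left this hsκ.le
      _ = M := by rw [← mul_assoc, mul_comm (√κ), hss, one_mul]
  have hmain : M * M ≤ (a0 + √κ * c0 + 2 * K1 + 6 * s * K2) * M := by
    have i1 := abs_le.1 (hinner t0 ht0)
    have i2 := abs_le.1 (hinner 0 h00)
    have i3 := abs_le.1 hint
    have i4 : a0 ^ 2 ≤ a0 * M := by
      rw [pow_two]; exact mul_le_mul_of_nonneg_left ha0M (norm_nonneg _)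
    have i5 : κ * c0 ^ 2 ≤ √κ * c0 * M := by
      calc κ * c0 ^ 2 = √κ * √κ * c0 ^ 2 := by rw [hsq]
        _ = (√κ * c0) * (√κ * c0) := by ring
        _ ≤ _ := mul_le_mul_of_nonneg_left hc0M (by positivity)
    have i6 : ‖ι (Q (z 0))‖ = a0 := by rw [hz0]
    have i7 : ‖Q (y 0)‖ = c0 := by rw [hy0]
    rw [hMM, hM2]
    rw [i6, i7] at e0
    exact energy_le_of_eq e0 i1.2 i2.1 i3.2 i4 i5
  have hMR : M ≤ R := by
    refine le_trans ?_ hR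
    -- Division by `M` fails only for `M = 0`, where the bound is the nonnegativity of the data
    -- terms.
    rcases hM0.eq_or_lt with h0 | h0
    · have hK10 : 0 ≤ K1 := integral_nonneg fun _ => norm_nonneg _
      have hK20 : 0 ≤ K2 := add_nonneg (norm_nonneg _) hI0
      exact h0.symm.le.trans (add_nonneg (add_nonneg (add_nonneg (norm_nonneg _)
        (mul_nonneg hsκ.le (norm_nonneg _))) (mul_nonneg zero_le_two hK10))
        (mul_nonneg (mul_nonneg (by norm_num) hs0.le) hK20))
    · exact le_of_mul_le_mul_right hmain h0
  exact fun t ht => ⟨(hle t ht).1.trans hMR,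
    (hle t ht).2.trans (mul_le_mul_of_nonneg_left hMR hs0.le)⟩

end IsWave

end Energy

/-! ### Passage to the limit in the regularization -/

section Limit

/-- Letting `m → ∞` in the splitting `r n + r m` keeps the explicit rate `r n`, which makes the
convergence uniform in time when `r` does not depend on time. -/
theorem exists_tendsto_of_norm_sub_le {X : Type*} [NormedAddCommGroup X] [CompleteSpace X]
    {x : ℕ → X} {r : ℕ → ℝ} (hr : Tendsto r atTop (𝓝 0)) (h : ∀ n m, ‖x n - x m‖ ≤ r n + r m) :
    ∃ l, Tendsto x atTop (𝓝 l) ∧ ∀ n, ‖x n - l‖ ≤ r n := by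
  have hc : CauchySeq x := by
    rw [Metric.cauchySeq_iff]
    intro ε hε
    obtain ⟨N, hN⟩ := (hr.eventually (gt_mem_nhds (half_pos hε))).exists_forall_of_atTop
    exact ⟨N, fun m hm n hn => by rw [dist_eq_norm]; linarith [h m n, hN m hm, hN n hn]⟩
  obtain ⟨l, hl⟩ := cauchySeq_tendsto_of_complete hc
  refine ⟨l, hl, fun n => ?_⟩
  have h1 : Tendsto (fun m => r n + r m) atTop (𝓝 (r n)) := by
    simpa using tendsto_const_nhds.add hr
  exact le_of_tendsto_of_tendsto' (tendsto_const_nhds.sub hl).norm h1 (h n)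

/-- A sequence of continuous functions that is uniformly Cauchy on `[0, T]` converges uniformly to
a continuous function. -/
theorem exists_continuousOn_limit {X : Type*} [NormedAddCommGroup X] [CompleteSpace X] {T : ℝ}
    {f : ℕ → ℝ → X} (hf : ∀ n, ContinuousOn (f n) (Icc 0 T)) {r : ℕ → ℝ}
    (hr : Tendsto r atTop (𝓝 0)) (h : ∀ n m, ∀ t ∈ Icc 0 T, ‖f n t - f m t‖ ≤ r n + r m) :
    ∃ g : ℝ → X, ContinuousOn g (Icc 0 T) ∧
      (∀ t ∈ Icc 0 T, Tendsto (fun n => f n t) atTop (𝓝 (g t))) ∧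
      ∀ n, ∀ t ∈ Icc 0 T, ‖f n t - g t‖ ≤ r n := by
  -- Outside `[0, T]` nothing is known about the sequence and the limit function is set to `0`.
  have hex : ∀ t, ∃ l, t ∈ Icc 0 T →
      Tendsto (fun n => f n t) atTop (𝓝 l) ∧ ∀ n, ‖f n t - l‖ ≤ r n := by
    intro t
    by_cases ht : t ∈ Icc 0 T
    · obtain ⟨l, hl⟩ := exists_tendsto_of_norm_sub_le hr fun n m => h n m t ht
      exact ⟨l, fun _ => hl⟩
    · exact ⟨0, fun h => absurd h ht⟩
  choose g hg using hex
  refine ⟨g, ?_, fun t ht => (hg t ht).1, fun n t ht => (hg t ht).2 n⟩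
  have hu : TendstoUniformlyOn f g atTop (Icc 0 T) := by
    rw [Metric.tendstoUniformlyOn_iff]
    intro ε hε
    filter_upwards [hr.eventually (gt_mem_nhds hε)] with n hn t ht
    rw [dist_comm, dist_eq_norm]
    exact ((hg t ht).2 n).trans_lt hn
  exact hu.continuousOn (Eventually.of_forall hf).frequently

variable {W K : Type*} [NormedAddCommGroup W] [InnerProductSpace ℝ W] [CompleteSpace W]
  [NormedAddCommGroup K] [InnerProductSpace ℝ K] [CompleteSpace K]

theorem norm_sub_le_add_norm_sub {X : Type*} [NormedAddCommGroup X] (a b x : X) :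
    ‖a - b‖ ≤ ‖a - x‖ + ‖b - x‖ := by
  rw [← sub_sub_sub_cancel_right a b x]
  exact norm_sub_le _ _

theorem tendsto_integral_norm_sub {X : Type*} [NormedAddCommGroup X] [NormedSpace ℝ X] {T : ℝ}
    {A : ℕ → X →L[ℝ] X} (hA : ∀ n x, ‖A n x - x‖ ≤ 2 * ‖x‖)
    (hlim : ∀ x, Tendsto (fun n => A n x) atTop (𝓝 x)) {f : ℝ → X}
    (hf : Integrable f (timeMeasure T)) :
    Tendsto (fun n => ∫ s, ‖A n (f s) - f s‖ ∂(timeMeasure T)) atTop (𝓝 0) := by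
  have h := tendsto_integral_of_dominated_convergence (μ := timeMeasure T)
    (F := fun n s => ‖A n (f s) - f s‖) (f := fun _ => (0 : ℝ)) (fun s => 2 * ‖f s‖)
    (fun n => (((A n).integrable_comp hf).sub hf).norm.aestronglyMeasurable)
    (hf.norm.const_mul 2)
    (fun n => Eventually.of_forall fun s => by rw [norm_norm]; exact hA n (f s))
    (Eventually.of_forall fun s => by
      simpa using (tendsto_sub_nhds_zero_iff.2 (hlim (f s))).norm)
  simpa using h

theorem integral_norm_sub_le {X : Type*} [NormedAddCommGroup X] [NormedSpace ℝ X] {T : ℝ}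
    (A B : X →L[ℝ] X) {f : ℝ → X} (hf : Integrable f (timeMeasure T)) :
    ∫ s, ‖A (f s) - B (f s)‖ ∂(timeMeasure T) ≤
      (∫ s, ‖A (f s) - f s‖ ∂(timeMeasure T)) + ∫ s, ‖B (f s) - f s‖ ∂(timeMeasure T) := by
  have hA := A.integrable_comp hf
  have hB := B.integrable_comp hf
  have h1 : Integrable (fun s => ‖A (f s) - f s‖) (timeMeasure T) := (hA.sub hf).norm
  have h2 : Integrable (fun s => ‖B (f s) - f s‖) (timeMeasure T) := (hB.sub hf).norm
  rw [← integral_add h1 h2]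
  exact integral_mono (hA.sub hB).norm (h1.add h2) fun s => norm_sub_le_add_norm_sub _ _ _

namespace IsWave

variable {T κ : ℝ} {ι : W →L[ℝ] K} {u y z f2 : ℝ → W} {F1 : ℝ → K} {F2 F2' : ℝ → W}
  {u0 : W} {u0' : K}

/-- A weak solution of the wave equation is continuous with values in the energy space, and it
satisfies the energy identity. -/
theorem exists_continuous_energy (hκ : 0 < κ) (hT : 0 < T) (hι : Function.Injective ι)
    (hd : DenseRange ι) (h : IsWave T κ ι u y z f2 F1 F2 F2' u0 u0') {ut : ℝ → K}
    (hut : ∀ᵐ t ∂(timeMeasure T), z t = ι.adjoint (ut t)) :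
    ∃ (uc : ℝ → W) (utc : ℝ → K), ContinuousOn uc (Icc 0 T) ∧ ContinuousOn utc (Icc 0 T) ∧
      u =ᵐ[timeMeasure T] uc ∧ ut =ᵐ[timeMeasure T] utc ∧ uc 0 = u0 ∧ utc 0 = u0' ∧
      IsPrim T (fun t => ι (uc t)) utc ∧
      IsPrim T (fun t => ‖utc t‖ ^ 2 + κ * ‖uc t‖ ^ 2 - 2 * ⟪F2 t, uc t⟫)
        (fun t => 2 * ⟪F1 t, utc t⟫ - 2 * ⟪F2' t, uc t⟫) := by
  have hsκ : 0 < √κ := Real.sqrt_pos.2 hκ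
  let ε : ℕ → ℝ := fun n => 1 / ((n : ℝ) + 1)
  have hε : ∀ n, 0 < ε n := fun n => Nat.one_div_pos_of_nat
  have hε0 : Tendsto ε atTop (𝓝 0) := tendsto_one_div_add_atTop_nhds_zero_nat
  choose Q hQ using fun n => exists_isResolvent ι (hε n)
  have hlimW := tendsto_resolvent hι hε hε0 hQ
  have hlimK := tendsto_resolvent_pivot hι hd hε hε0 hQ
  have h00 : (0 : ℝ) ∈ Icc 0 T := ⟨le_rfl, hT.le⟩
  let A : ℕ → W →L[ℝ] W := fun n => (Q n).comp (ι.adjoint.comp ι)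
  let D : ℕ → K →L[ℝ] K := fun n => ι.comp ((Q n).comp ι.adjoint)
  have hA2 : ∀ n x, ‖A n x - x‖ ≤ 2 * ‖x‖ := fun n x =>
    ((hQ n).norm_sub_le (hε n) x).trans (by linarith [norm_nonneg x])
  have hD2 : ∀ n x, ‖D n x - x‖ ≤ 2 * ‖x‖ := fun n x =>
    (norm_sub_le _ _).trans (by
      have h1 : ‖D n x‖ ≤ ‖x‖ := (hQ n).norm_pivot_le (hε n) x
      linarith)
  -- The data terms of `IsWave.norm_le`, with each regularized datum replaced by its approximation
  -- error.
  let r : ℕ → ℝ := fun n => ‖D n u0' - u0'‖ + √κ * ‖A n u0 - u0‖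
    + 2 * (∫ s, ‖D n (F1 s) - F1 s‖ ∂(timeMeasure T))
    + 6 * (√κ)⁻¹ * (‖A n (F2 0) - F2 0‖ + ∫ s, ‖A n (F2' s) - F2' s‖ ∂(timeMeasure T))
  have hr : Tendsto r atTop (𝓝 0) := by
    have t1 : Tendsto (fun n => ‖D n u0' - u0'‖) atTop (𝓝 0) := 
      tendsto_iff_norm_sub_tendsto_zero.1 (hlimK u0')
    have t2 : Tendsto (fun n => ‖A n u0 - u0‖) atTop (𝓝 0) := 
      tendsto_iff_norm_sub_tendsto_zero.1 (hlimW u0)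
    have t3 : Tendsto (fun n => ‖A n (F2 0) - F2 0‖) atTop (𝓝 0) := 
      tendsto_iff_norm_sub_tendsto_zero.1 (hlimW (F2 0))
    have t4 := tendsto_integral_norm_sub hD2 hlimK h.integrable_F1
    have t5 := tendsto_integral_norm_sub hA2 hlimW h.prim_F2.integrable
    simpa using ((t1.add (t2.const_mul (√κ))).add (t4.const_mul 2)).add
      ((t3.add t5).const_mul (6 * (√κ)⁻¹))
  have hbound : ∀ n m, ∀ t ∈ Icc 0 T, ‖ι (Q n (z t)) - ι (Q m (z t))‖ ≤ r n + r m ∧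
      ‖Q n (y t) - Q m (y t)‖ ≤ (√κ)⁻¹ * (r n + r m) := by
    intro n m t ht
    -- The equation is linear and `Q n - Q m` commutes with `ι* ι`, so the energy estimate applies
    -- directly to the difference of two regularizations.
    have hcomm : ∀ v, (Q n - Q m) (ι.adjoint (ι v)) = ι.adjoint (ι ((Q n - Q m) v)) := fun v => by
      simp only [sub_apply, map_sub, (hQ n).comm, (hQ m).comm]
    have key := h.norm_le hκ hT (Q n - Q m) hcomm (R := r n + r m) (by
      have i1 : ‖ι (Q n (ι.adjoint u0')) - ι (Q m (ι.adjoint u0'))‖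
        ≤ ‖D n u0' - u0'‖ + ‖D m u0' - u0'‖ := norm_sub_le_add_norm_sub _ _ _
      have i2 : ‖Q n (ι.adjoint (ι u0)) - Q m (ι.adjoint (ι u0))‖
        ≤ ‖A n u0 - u0‖ + ‖A m u0 - u0‖ := norm_sub_le_add_norm_sub _ _ _
      have i3 : ‖Q n (ι.adjoint (ι (F2 0))) - Q m (ι.adjoint (ι (F2 0)))‖
        ≤ ‖A n (F2 0) - F2 0‖ + ‖A m (F2 0) - F2 0‖ := norm_sub_le_add_norm_sub _ _ _
      have i4 := integral_norm_sub_le (D n) (D m) h.integrable_F1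
      have i5 := integral_norm_sub_le (A n) (A m) h.prim_F2.integrable
      have i6 := mul_le_mul_of_nonneg_left i2 hsκ.le
      have i7 := mul_le_mul_of_nonneg_left (add_le_add i3 i5)
        (show 0 ≤ 6 * (√κ)⁻¹ by positivity)
      simp only [sub_apply, map_sub]
      simp only [A, D, ContinuousLinearMap.comp_apply] at i1 i4 i5 i6 i7
      simp only [r, A, D, ContinuousLinearMap.comp_apply]
      linarith) t ht
    simpa only [sub_apply, map_sub] using key
  have hsr : Tendsto (fun n => (√κ)⁻¹ * r n) atTop (𝓝 0) := by simpa using hr.const_mul (√κ)⁻¹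
  obtain ⟨uc, hucc, huclim, hucr⟩ := exists_continuousOn_limit
    (fun n => (h.prim_y.clm (Q n)).continuousOn) hsr fun n m t ht => by
      rw [← mul_add]; exact (hbound n m t ht).2
  obtain ⟨utc, hutcc, hutclim, hutcr⟩ := exists_continuousOn_limit
    (fun n => (h.prim_z.clm (ι.comp (Q n))).continuousOn) hr fun n m t ht => (hbound n m t ht).1
  obtain ⟨B, hB⟩ : ∃ B, ∀ n, |r n| ≤ B := by
    obtain ⟨B, hB⟩ := hr.abs.bddAbove_range
    exact ⟨B, fun n => hB (mem_range_self n)⟩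
  obtain ⟨C1, hC10, hC1⟩ := exists_norm_le_of_continuousOn_Icc hucc
  obtain ⟨C2, hC20, hC2⟩ := exists_norm_le_of_continuousOn_Icc hutcc
  have hB0 : 0 ≤ B := (abs_nonneg _).trans (hB 0)
  have hwb : ∀ n, ∀ t ∈ Icc 0 T, ‖Q n (y t)‖ ≤ C1 + (√κ)⁻¹ * B := by
    intro n t ht
    have h1 := norm_add_le (Q n (y t) - uc t) (uc t)
    rw [sub_add_cancel] at h1
    have h2 := mul_le_mul_of_nonneg_left ((le_abs_self _).trans (hB n)) (inv_pos.2 hsκ).le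
    linarith [hucr n t ht, hC1 t ht]
  have hzb : ∀ n, ∀ t ∈ Icc 0 T, ‖ι (Q n (z t))‖ ≤ C2 + B := by
    intro n t ht
    have h1 := norm_add_le (ι (Q n (z t)) - utc t) (utc t)
    rw [sub_add_cancel] at h1
    have h2 := (le_abs_self _).trans (hB n)
    have h3 : ‖ι (Q n (z t)) - utc t‖ ≤ r n := hutcr n t ht
    linarith [hC2 t ht]
  refine ⟨uc, utc, hucc, hutcc, ?_, ?_, ?_, ?_, ?_, ?_⟩
  · filter_upwards [h.y_eq, ae_mem_Icc_timeMeasure T] with t hy ht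
    refine tendsto_nhds_unique ?_ (huclim t ht)
    rw [hy]; exact hlimW (u t)
  · filter_upwards [hut, ae_mem_Icc_timeMeasure T] with t hy ht
    refine tendsto_nhds_unique ?_ (hutclim t ht)
    rw [hy]; exact hlimK (ut t)
  · refine tendsto_nhds_unique (huclim 0 h00) ?_
    rw [h.y_zero]; exact hlimW u0
  · refine tendsto_nhds_unique (hutclim 0 h00) ?_
    rw [h.z_zero]; exact hlimK u0'
  · refine IsPrim.of_tendsto (fun n => h.prim_y.clm (ι.comp (Q n))) (integrable_const (C2 + B))
      (fun n => ?_) (fun t ht => (ι.continuous.tendsto _).comp (huclim t ht)) ?_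
    · filter_upwards [ae_mem_Icc_timeMeasure T] with t ht using hzb n t ht
    · filter_upwards [ae_mem_Icc_timeMeasure T] with t ht using hutclim t ht
  · refine IsPrim.of_tendsto (fun n => h.isPrim_energy (Q n) (hQ n).comm)
      (bound := fun t => 2 * (‖F1 t‖ * (C2 + B)) + 2 * ((2 * ‖F2' t‖) * (C1 + (√κ)⁻¹ * B)))
      (((h.integrable_F1.norm.mul_const _).const_mul 2).add
        (((h.prim_F2.integrable.norm.const_mul 2).mul_const _).const_mul 2))
      (fun n => ?_) (fun t ht => ?_) ?_
    · filter_upwards [ae_mem_Icc_timeMeasure T] with t ht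
      refine (norm_sub_le _ _).trans (add_le_add ?_ ?_)
      · rw [norm_mul, Real.norm_two]
        refine mul_le_mul_of_nonneg_left ((abs_real_inner_le_norm _ _).trans ?_) zero_le_two
        exact mul_le_mul ((hQ n).norm_pivot_le (hε n) _) (hzb n t ht) (norm_nonneg _)
          (norm_nonneg _)
      · rw [norm_mul, Real.norm_two]
        refine mul_le_mul_of_nonneg_left ((abs_real_inner_le_norm _ _).trans ?_) zero_le_two
        refine mul_le_mul ?_ (hwb n t ht) (norm_nonneg _) (by positivity)
        have h1 := norm_add_le (Q n (ι.adjoint (ι (F2' t))) - F2' t) (F2' t)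
        rw [sub_add_cancel] at h1
        linarith [(hQ n).norm_sub_le (hε n) (F2' t)]
    · exact (((hutclim t ht).norm.pow 2).add (((huclim t ht).norm.pow 2).const_mul κ)).sub
        (((hlimW (F2 t)).inner (huclim t ht)).const_mul 2)
    · filter_upwards [ae_mem_Icc_timeMeasure T] with t ht
      exact (((hlimK (F1 t)).inner (hutclim t ht)).const_mul 2).sub
        (((hlimW (F2' t)).inner (huclim t ht)).const_mul 2)

end IsWave

end Limit

/-! ### The Hilbert triple `V ⊂ H ⊂ V*` -/

section Space

variable {Ω : Set E3}

theorem memLp_test {X : Type*} [NormedAddCommGroup X] {ψ : E3 → X} (hc : Continuous ψ)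
    (hs : HasCompactSupport ψ) : MemLp ψ 2 (volume.restrict Ω) :=
  (hc.memLp_of_hasCompactSupport (μ := volume) hs).restrict Ω

/-- A square integrable function that is orthogonal to all test functions vanishes. -/
theorem lp_eq_zero_of_integral_test {X : Type*} [NormedAddCommGroup X] [NormedSpace ℝ X]
    [CompleteSpace X] (hΩ : IsOpen Ω) (f : Lp X 2 (volume.restrict Ω))
    (h : ∀ φ : E3 → ℝ, ContDiff ℝ ∞ φ → HasCompactSupport φ → tsupport φ ⊆ Ω →
      ∫ x in Ω, φ x • f x = 0) : f = 0 := by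
  have h2 : LocallyIntegrableOn f Ω volume :=
    locallyIntegrableOn_of_locallyIntegrable_restrict
      ((Lp.memLp f).locallyIntegrable (by norm_num))
  have h3 := hΩ.ae_eq_zero_of_integral_contDiff_smul_eq_zero h2 fun φ hφ hc hs => by
    rw [← h φ hφ hc hs, setIntegral_eq_integral_of_forall_compl_eq_zero]
    intro x hx
    rw [image_eq_zero_of_notMem_tsupport fun hm => hx (hs hm), zero_smul]
  refine Lp.eq_zero_iff_ae_eq_zero.2 ?_
  exact (ae_restrict_iff' hΩ.measurableSet).2 h3

theorem inner_H_eq (f g : H Ω) : ⟪f, g⟫ = ∫ x in Ω, f x * g x := by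
  rw [L2.inner_def]
  exact integral_congr_ae (Eventually.of_forall fun x => mul_comm _ _)

/-- Each test condition is an equality between continuous functionals of `(f, F)`. The resulting
completeness of `V` is what allows adjoints, Riesz representation and Lax–Milgram. -/
theorem isClosed_sobolevSubmodule (Ω : Set E3) :
    IsClosed (sobolevSubmodule Ω : Set (WithLp 2 (H Ω × HH Ω))) := by
  have h1 : (sobolevSubmodule Ω : Set (WithLp 2 (H Ω × HH Ω)))
      = ⋂ (φ : E3 → ℝ) (hφ : ContDiff ℝ ∞ φ) (hc : HasCompactSupport φ) (_ : tsupport φ ⊆ Ω)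
        (w : E3), {p | ⟪p.fst, (memLp_test (Ω := Ω) (continuous_fderiv_apply_test hφ w)
          (hc.fderiv_apply ℝ w)).toLp⟫ = -⟪p.snd, (memLp_test (Ω := Ω)
            (hφ.continuous.smul (continuous_const (y := w))) hc.smul_right).toLp⟫} := by
    ext p
    simp only [mem_iInter, mem_ofPred_eq]
    refine forall_congr' fun φ => forall_congr' fun hφ => forall_congr' fun hc =>
      forall_congr' fun _ => forall_congr' fun w => ?_
    rw [inner_H_eq, L2.inner_def]
    refine Eq.congr (integral_congr_ae ?_) (congrArg _ (integral_congr_ae ?_))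
    · filter_upwards [(memLp_test (Ω := Ω) (continuous_fderiv_apply_test hφ w)
        (hc.fderiv_apply ℝ w)).coeFn_toLp] with x hx
      rw [hx]
    · filter_upwards [(memLp_test (Ω := Ω) (hφ.continuous.smul (continuous_const (y := w)))
        hc.smul_right).coeFn_toLp] with x hx
      rw [hx, Pi.smul_apply', inner_smul_right, mul_comm]
  rw [h1]
  refine isClosed_iInter fun φ => isClosed_iInter fun hφ => isClosed_iInter fun hc =>
    isClosed_iInter fun _ => isClosed_iInter fun w => isClosed_eq ?_ ?_
  · exact (WithLp.fstL 2 ℝ (H Ω) (HH Ω)).continuous.inner continuous_const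
  · exact ((WithLp.sndL 2 ℝ (H Ω) (HH Ω)).continuous.inner continuous_const).neg

instance completeSpace_V (Ω : Set E3) : CompleteSpace (V Ω) :=
  (isClosed_sobolevSubmodule Ω).completeSpace_coe

theorem inner_V_eq (v w : V Ω) : ⟪v, w⟫ = ⟪toH Ω v, toH Ω w⟫ + ⟪grad Ω v, grad Ω w⟫ := rfl

theorem norm_V_sq (v : V Ω) : ‖v‖ ^ 2 = ‖toH Ω v‖ ^ 2 + ‖grad Ω v‖ ^ 2 := by
  rw [← real_inner_self_eq_norm_sq, inner_V_eq, real_inner_self_eq_norm_sq,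
    real_inner_self_eq_norm_sq]

theorem isWeakGrad_V (v : V Ω) : IsWeakGrad Ω (toH Ω v) (grad Ω v) := v.2

/-- A pair `(0, F)` in `V` has `F = 0`, because weak gradients are unique. -/
theorem injective_toH (hΩ : IsOpen Ω) : Function.Injective (toH Ω) := by
  rw [injective_iff_map_eq_zero]
  intro v hv
  have hg : grad Ω v = 0 := by
    refine lp_eq_zero_of_integral_test hΩ _ fun φ hφ hc hs => ?_
    have hi : Integrable (fun x => φ x • grad Ω v x) (volume.restrict Ω) :=
      memLp_one_iff_integrable.1 ((Lp.memLp (grad Ω v)).smul (memLp_test hφ.continuous hc))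
    refine ext_inner_right ℝ fun w => ?_
    rw [inner_zero_left, real_inner_comm, ← integral_inner hi w]
    have h1 := isWeakGrad_V v φ hφ hc hs w
    rw [hv] at h1
    have h2 : ∫ x in Ω, (0 : H Ω) x * fderiv ℝ φ x w = 0 := by
      apply integral_eq_zero_of_ae
      filter_upwards [Lp.coeFn_zero ℝ 2 (volume.restrict Ω)] with x hx
      rw [hx, Pi.zero_apply, zero_mul]
    rw [h2, eq_comm, neg_eq_zero] at h1
    rw [← h1]
    refine integral_congr_ae (Eventually.of_forall fun x => ?_)
    simp only [inner_smul_right, real_inner_comm w, mul_comm]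
  rw [← norm_eq_zero, ← sq_eq_zero_iff, norm_V_sq, hv, hg]
  simp

/-- A test function is an element of `H¹(Ω)`. -/
theorem exists_toH_ae_eq_test {φ : E3 → ℝ} (hφ : ContDiff ℝ ∞ φ)
    (hc : HasCompactSupport φ) : ∃ v : V Ω, toH Ω v =ᵐ[volume.restrict Ω] φ := by
  let R := (InnerProductSpace.toDual ℝ E3).symm
  let g : E3 → E3 := fun x => R (fderiv ℝ φ x)
  have hgw : ∀ x w, ⟪g x, w⟫ = fderiv ℝ φ x w := fun x w =>
    InnerProductSpace.toDual_symm_apply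
  have hgc : Continuous g := R.continuous.comp (hφ.continuous_fderiv (by simp))
  have hgs : HasCompactSupport g := (hc.fderiv ℝ).comp_left (map_zero R)
  have m1 : MemLp φ 2 (volume.restrict Ω) := memLp_test hφ.continuous hc
  have m2 : MemLp g 2 (volume.restrict Ω) := memLp_test hgc hgs
  refine ⟨⟨WithLp.toLp 2 (m1.toLp, m2.toLp), ?_⟩, m1.coeFn_toLp⟩
  intro ψ hψ hψc hψs w
  change ∫ x in Ω, (m1.toLp : H Ω) x * fderiv ℝ ψ x w
    = - ∫ x in Ω, ⟪(m2.toLp : HH Ω) x, w⟫ * ψ x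
  have e1 : ∫ x in Ω, (m1.toLp : H Ω) x * fderiv ℝ ψ x w = ∫ x in Ω, φ x * fderiv ℝ ψ x w :=
    integral_congr_ae (m1.coeFn_toLp.mono fun x hx => by simp only [hx])
  have e2 : ∫ x in Ω, ⟪(m2.toLp : HH Ω) x, w⟫ * ψ x = ∫ x in Ω, fderiv ℝ φ x w * ψ x :=
    integral_congr_ae (m2.coeFn_toLp.mono fun x hx => by simp only [hx, hgw])
  -- Since `ψ` and its derivative vanish off `Ω`, the integrals extend to the whole space, where
  -- integration by parts has no boundary term.
  have hz : ∀ x, x ∉ Ω → ψ x = 0 := fun x hx =>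
    image_eq_zero_of_notMem_tsupport fun hm => hx (hψs hm)
  have hz' : ∀ x, x ∉ Ω → fderiv ℝ ψ x w = 0 := fun x hx => by
    have : fderiv ℝ ψ x = 0 := image_eq_zero_of_notMem_tsupport fun hm =>
      hx (hψs (tsupport_fderiv_subset ℝ hm))
    rw [this]; rfl
  rw [e1, e2, setIntegral_eq_integral_of_forall_compl_eq_zero fun x hx => by
      rw [hz' x hx, mul_zero],
    setIntegral_eq_integral_of_forall_compl_eq_zero fun x hx => by rw [hz x hx, mul_zero]]
  have c1 := continuous_fderiv_apply_test hφ w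
  have c2 := continuous_fderiv_apply_test hψ w
  refine integral_mul_fderiv_eq_neg_fderiv_mul_of_integrable ?_ ?_ ?_
    (fun x _ => hφ.differentiable (by simp) x) (fun x _ => hψ.differentiable (by simp) x)
  · exact (c1.mul hψ.continuous).integrable_of_hasCompactSupport hψc.mul_left
  · exact (hφ.continuous.mul c2).integrable_of_hasCompactSupport hc.mul_right
  · exact (hφ.continuous.mul hψ.continuous).integrable_of_hasCompactSupport hc.mul_right

theorem denseRange_toH (hΩ : IsOpen Ω) : DenseRange (toH Ω) := by
  have : Dense ((toH Ω).range : Set (H Ω)) := by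
    rw [Submodule.dense_iff_topologicalClosure_eq_top, Submodule.topologicalClosure_eq_top_iff,
      Submodule.eq_bot_iff]
    intro h hh
    refine lp_eq_zero_of_integral_test hΩ h fun φ hφ hc _ => ?_
    obtain ⟨v, hv⟩ := exists_toH_ae_eq_test (Ω := Ω) hφ hc
    have h1 : ⟪toH Ω v, h⟫ = 0 := hh _ ⟨v, rfl⟩
    rw [inner_H_eq] at h1
    rw [← h1]
    exact integral_congr_ae (hv.mono fun x hx => by simp only [hx, smul_eq_mul])
  exact this

end Space

/-! ### The superposition operator on `L²` and its chain rule in time -/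

section Superposition

/-- `g` vanishes at `0`, and its derivative `g'` is bounded and Lipschitz continuous. -/
structure HasLipschitzDeriv (g g' : ℝ → ℝ) (C K : ℝ) : Prop where
  zero : g 0 = 0
  hasDerivAt : ∀ x, HasDerivAt g (g' x) x
  bound : ∀ x, |g' x| ≤ C
  lipschitz : ∀ x y, |g' x - g' y| ≤ K * |x - y|

/-- If `G ≥ 0` is of class `C¹` with `G 0 = 0`, then `G sign` is of class `C¹`. -/
theorem hasLipschitzDeriv_mul_sign {G γ : ℝ → ℝ} (hG : ContDiff ℝ 1 G) (hGnn : ∀ r, 0 ≤ G r)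
    (hG0 : G 0 = 0) {C : ℝ} (hC : ∀ r, |deriv G r| ≤ C) {K : NNReal}
    (hK : LipschitzWith K (deriv G)) (hγ : ∀ r, γ r = G r * Real.sign r) :
    HasLipschitzDeriv γ (fun r => deriv G r * Real.sign r) C K := by
  have hd : ∀ r, HasDerivAt G (deriv G r) r := fun r =>
    (hG.differentiable one_ne_zero r).hasDerivAt
  -- `0` is a minimum of `G`; hence multiplying by the sign creates neither a kink in `γ` nor a jump
  -- in its derivative.
  have hd0 : deriv G 0 = 0 :=
    IsLocalMin.deriv_eq_zero (Eventually.of_forall fun r => by rw [hG0]; exact hGnn r)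
  have hL : ∀ x y, |deriv G x - deriv G y| ≤ K * |x - y| := fun x y => by
    simpa [Real.dist_eq] using hK.dist_le_mul x y
  have hγe : γ = fun r => G r * Real.sign r := funext hγ
  refine ⟨by rw [hγ, hG0, zero_mul], fun r => ?_, fun r => ?_, fun x y => ?_⟩
  · rcases lt_trichotomy r 0 with h | h | h
    · rw [Real.sign_of_neg h]
      refine ((hd r).mul_const (-1)).congr_of_eventuallyEq ?_
      filter_upwards [gt_mem_nhds h] with s hs
      rw [hγ, Real.sign_of_neg hs]
    · subst h
      have h1 := hd 0
      rw [hd0, hasDerivAt_iff_isLittleO] at h1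
      rw [hd0, zero_mul, hasDerivAt_iff_isLittleO]
      refine (Asymptotics.isBigO_of_le _ fun s => ?_).trans_isLittleO h1
      rw [hγ, hγ, hG0]
      simp only [zero_mul, sub_zero, smul_zero, norm_mul]
      refine mul_le_of_le_one_right (norm_nonneg _) ?_
      rcases Real.sign_apply_eq s with h | h | h <;> simp [h]
    · rw [Real.sign_of_pos h]
      refine ((hd r).mul_const 1).congr_of_eventuallyEq ?_
      filter_upwards [lt_mem_nhds h] with s hs
      rw [hγ, Real.sign_of_pos hs]
  · refine le_trans ?_ (hC r)
    rw [abs_mul]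
    refine mul_le_of_le_one_right (abs_nonneg _) ?_
    rcases Real.sign_apply_eq r with h | h | h <;> simp [h]
  · have h0 : ∀ x, |deriv G x| ≤ K * |x| := fun x => by simpa [hd0] using hL x 0
    -- For arguments of opposite sign `|x - y| = |x| + |y|`, so the Lipschitz bound passes through
    -- `0`, where the derivative vanishes, without loss in the constant.
    have hopp : ∀ x y, x < 0 → 0 < y → |deriv G x + deriv G y| ≤ K * |x - y| := by
      intro x y hx hy
      have e : |x - y| = |x| + |y| := by
        rw [abs_of_neg hx, abs_of_pos hy, abs_of_neg (by linarith)]; ring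
      rw [e, mul_add]
      exact (abs_add_le _ _).trans (add_le_add (h0 x) (h0 y))
    rcases lt_trichotomy x 0 with hx | hx | hx <;> rcases lt_trichotomy y 0 with hy | hy | hy
    · simp only [Real.sign_of_neg hx, Real.sign_of_neg hy]
      rw [← sub_mul, abs_mul]; simpa using hL x y
    · subst hy
      simp only [Real.sign_of_neg hx, Real.sign_zero]
      simpa using h0 x
    · simp only [Real.sign_of_neg hx, Real.sign_of_pos hy]
      rw [← abs_neg]
      simpa [add_comm] using hopp x y hx hy
    · subst hx
      simp only [Real.sign_of_neg hy, Real.sign_zero]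
      simpa using h0 y
    · subst hx; subst hy; simp
    · subst hx
      simp only [Real.sign_of_pos hy, Real.sign_zero]
      simpa using h0 y
    · simp only [Real.sign_of_pos hx, Real.sign_of_neg hy]
      rw [abs_sub_comm x y]
      simpa [add_comm] using hopp y x hy hx
    · subst hy
      simp only [Real.sign_of_pos hx, Real.sign_zero]
      simpa using h0 x
    · simp only [Real.sign_of_pos hx, Real.sign_of_pos hy]
      simpa using hL x y

namespace HasLipschitzDeriv

variable {g g' : ℝ → ℝ} {C K : ℝ}

theorem nonneg (h : HasLipschitzDeriv g g' C K) : 0 ≤ C := (abs_nonneg _).trans (h.bound 0)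

theorem nonneg_lip (h : HasLipschitzDeriv g g' C K) : 0 ≤ K := by
  have := (abs_nonneg _).trans (h.lipschitz 1 0)
  simpa using this

theorem continuous_deriv (h : HasLipschitzDeriv g g' C K) : Continuous g' := by
  have : LipschitzWith (Real.toNNReal K) g' := LipschitzWith.of_dist_le_mul fun x y => by
    rw [Real.coe_toNNReal _ h.nonneg_lip]; exact h.lipschitz x y
  exact this.continuous

theorem lipschitzWith (h : HasLipschitzDeriv g g' C K) : LipschitzWith (Real.toNNReal C) g :=
  lipschitzWith_of_nnnorm_deriv_le (fun x => (h.hasDerivAt x).differentiableAt) fun x => by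
    rw [← NNReal.coe_le_coe, Real.coe_toNNReal _ h.nonneg, coe_nnnorm, (h.hasDerivAt x).deriv]
    exact h.bound x

/-- Mean value inequality for `x ↦ g x - g' a x`, whose derivative is at most `K |b|` between `a`
and `a + b`. -/
theorem abs_sub_le (h : HasLipschitzDeriv g g' C K) (a b : ℝ) :
    |g (a + b) - g a - g' a * b| ≤ K * b ^ 2 := by
  have hd : ∀ x ∈ uIcc a (a + b), HasDerivWithinAt (fun x => g x - g' a * x) (g' x - g' a)
      (uIcc a (a + b)) x := fun x _ => by
    have h1 := (hasDerivAt_id x).const_mul (g' a)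
    rw [mul_one] at h1
    exact ((h.hasDerivAt x).sub h1).hasDerivWithinAt
  have hb : ∀ x ∈ uIcc a (a + b), ‖g' x - g' a‖ ≤ K * |b| := fun x hx => by
    refine (h.lipschitz x a).trans (mul_le_mul_of_nonneg_left ?_ h.nonneg_lip)
    simpa using abs_sub_left_of_mem_uIcc hx
  have key := (convex_uIcc a (a + b)).norm_image_sub_le_of_norm_hasDerivWithin_le hd hb
    left_mem_uIcc right_mem_uIcc
  rw [Real.norm_eq_abs, Real.norm_eq_abs, add_sub_cancel_left] at key
  calc |g (a + b) - g a - g' a * b| = |g (a + b) - g' a * (a + b) - (g a - g' a * a)| := by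
        congr 1; ring
    _ ≤ K * |b| * |b| := key
    _ = K * b ^ 2 := by rw [mul_assoc, abs_mul_abs_self, pow_two]

variable {Ω : Set E3}

theorem memLp_comp (h : HasLipschitzDeriv g g' C K) (f : H Ω) :
    MemLp (fun x => g (f x)) 2 (volume.restrict Ω) :=
  h.lipschitzWith.comp_memLp h.zero (Lp.memLp f)

theorem superpose_ae (h : HasLipschitzDeriv g g' C K) (f : H Ω) :
    superpose Ω g f =ᵐ[volume.restrict Ω] fun x => g (f x) := by
  rw [superpose, dif_pos (h.memLp_comp f)]
  exact (h.memLp_comp f).coeFn_toLp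

theorem memLp_deriv_mul (h : HasLipschitzDeriv g g' C K) (f k : H Ω) :
    MemLp (fun x => g' (f x) * k x) 2 (volume.restrict Ω) := by
  refine MemLp.of_le_mul (Lp.memLp k) ((h.continuous_deriv.comp_aestronglyMeasurable
    (Lp.aestronglyMeasurable f)).mul (Lp.aestronglyMeasurable k)) (c := C)
    (Eventually.of_forall fun x => ?_)
  rw [norm_mul]
  exact mul_le_mul_of_nonneg_right (h.bound _) (norm_nonneg _)

/-- The product `g'(f) k` in `L²(Ω)`. -/
noncomputable def derivMul (h : HasLipschitzDeriv g g' C K) (f k : H Ω) : H Ω :=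
  (h.memLp_deriv_mul f k).toLp

theorem derivMul_ae (h : HasLipschitzDeriv g g' C K) (f k : H Ω) :
    h.derivMul f k =ᵐ[volume.restrict Ω] fun x => g' (f x) * k x :=
  (h.memLp_deriv_mul f k).coeFn_toLp

theorem norm_derivMul_sub_le (h : HasLipschitzDeriv g g' C K) (f k k' : H Ω) :
    ‖h.derivMul f k - h.derivMul f k'‖ ≤ C * ‖k - k'‖ := by
  refine Lp.norm_le_mul_norm_of_ae_le_mul ?_
  filter_upwards [Lp.coeFn_sub (h.derivMul f k) (h.derivMul f k'), Lp.coeFn_sub k k',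
    h.derivMul_ae f k, h.derivMul_ae f k'] with x h1 h2 h3 h4
  rw [h1, h2, Pi.sub_apply, Pi.sub_apply, h3, h4, ← mul_sub, norm_mul]
  exact mul_le_mul_of_nonneg_right (h.bound _) (norm_nonneg _)

theorem norm_derivMul_le (h : HasLipschitzDeriv g g' C K) (f k : H Ω) :
    ‖h.derivMul f k‖ ≤ C * ‖k‖ := by
  refine Lp.norm_le_mul_norm_of_ae_le_mul ?_
  filter_upwards [h.derivMul_ae f k] with x h3
  rw [h3, norm_mul]
  exact mul_le_mul_of_nonneg_right (h.bound _) (norm_nonneg _)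

/-- A sup bound on `k` keeps `(g' f - g' f') k` in `L²` with a Lipschitz estimate in `f`; for
general `k` in `L²` only continuity is obtained, by density. -/
theorem norm_derivMul_sub_le_of_bound (h : HasLipschitzDeriv g g' C K) (f f' k : H Ω) {B : ℝ}
    (hk : ∀ᵐ x ∂(volume.restrict Ω), |k x| ≤ B) :
    ‖h.derivMul f k - h.derivMul f' k‖ ≤ K * B * ‖f - f'‖ := by
  refine Lp.norm_le_mul_norm_of_ae_le_mul ?_
  filter_upwards [Lp.coeFn_sub (h.derivMul f k) (h.derivMul f' k), Lp.coeFn_sub f f',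
    h.derivMul_ae f k, h.derivMul_ae f' k, hk] with x h1 h2 h3 h4 h5
  rw [h1, h2, Pi.sub_apply, Pi.sub_apply, h3, h4, ← sub_mul, norm_mul]
  calc ‖g' (f x) - g' (f' x)‖ * ‖k x‖ ≤ K * |f x - f' x| * B :=
        mul_le_mul (h.lipschitz _ _) h5 (norm_nonneg _)
          (mul_nonneg h.nonneg_lip (abs_nonneg _))
    _ = K * B * ‖f x - f' x‖ := by rw [Real.norm_eq_abs]; ring

end HasLipschitzDeriv

theorem dense_bounded {Ω : Set E3} (hΩ : IsOpen Ω) :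
    Dense {k : H Ω | ∃ B, ∀ᵐ x ∂(volume.restrict Ω), |k x| ≤ B} := by
  let S : Submodule ℝ (H Ω) :=
    { carrier := {k : H Ω | ∃ B, ∀ᵐ x ∂(volume.restrict Ω), |k x| ≤ B}
      zero_mem' := ⟨0, by
        filter_upwards [Lp.coeFn_zero ℝ 2 (volume.restrict Ω)] with x hx
        rw [hx, Pi.zero_apply, abs_zero]⟩
      add_mem' := by
        rintro k k' ⟨B, hB⟩ ⟨B', hB'⟩
        refine ⟨B + B', ?_⟩
        filter_upwards [Lp.coeFn_add k k', hB, hB'] with x hx h1 h2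
        rw [hx, Pi.add_apply]
        exact (abs_add_le _ _).trans (add_le_add h1 h2)
      smul_mem' := by
        rintro c k ⟨B, hB⟩
        refine ⟨|c| * B, ?_⟩
        filter_upwards [Lp.coeFn_smul c k, hB] with x hx h1
        rw [hx, Pi.smul_apply, smul_eq_mul, abs_mul]
        exact mul_le_mul_of_nonneg_left h1 (abs_nonneg _) }
  change Dense (S : Set (H Ω))
  rw [Submodule.dense_iff_topologicalClosure_eq_top, Submodule.topologicalClosure_eq_top_iff,
    Submodule.eq_bot_iff]
  intro f hf
  refine lp_eq_zero_of_integral_test hΩ f fun φ hφ hc _ => ?_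
  have m : MemLp φ 2 (volume.restrict Ω) := memLp_test hφ.continuous hc
  obtain ⟨B, hB⟩ := hφ.continuous.bounded_above_of_compact_support hc
  have h1 : ⟪m.toLp, f⟫ = 0 := hf _ ⟨B, m.coeFn_toLp.mono fun x hx => by rw [hx]; exact hB x⟩
  rw [inner_H_eq] at h1
  rw [← h1]
  exact integral_congr_ae (m.coeFn_toLp.mono fun x hx => by simp only [hx, smul_eq_mul])

namespace HasLipschitzDeriv

variable {g g' : ℝ → ℝ} {C K : ℝ} {Ω : Set E3}

/-- Lipschitz in `k` uniformly in `f`, and continuous in `f` for `k` in the dense set of bounded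
functions. It serves to make `t ↦ g'(f t) f' t` measurable with values in `L²`. -/
theorem continuous_derivMul (h : HasLipschitzDeriv g g' C K) (hΩ : IsOpen Ω) :
    Continuous fun p : H Ω × H Ω => h.derivMul p.2 p.1 := by
  refine continuous_prod_of_dense_continuous_lipschitzWith _ (Real.toNNReal C) (dense_bounded hΩ)
    ?_ fun f => ?_
  · rintro k ⟨B, hB⟩
    have : LipschitzWith (Real.toNNReal (K * B)) fun f => h.derivMul f k :=
      LipschitzWith.of_dist_le_mul fun f f' => by
        rw [dist_eq_norm, dist_eq_norm]
        exact (h.norm_derivMul_sub_le_of_bound f f' k hB).trans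
          (mul_le_mul_of_nonneg_right (Real.le_coe_toNNReal _) (norm_nonneg _))
    exact this.continuous
  · refine LipschitzWith.of_dist_le_mul fun k k' => ?_
    rw [dist_eq_norm, dist_eq_norm, Real.coe_toNNReal _ h.nonneg]
    exact h.norm_derivMul_sub_le f k k'

theorem inner_derivMul (h : HasLipschitzDeriv g g' C K) (f k p : H Ω) :
    ⟪h.derivMul f p, k⟫ = ⟪h.derivMul f k, p⟫ := by
  rw [inner_H_eq, inner_H_eq]
  refine integral_congr_ae ?_
  filter_upwards [h.derivMul_ae f p, h.derivMul_ae f k] with x h1 h2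
  rw [h1, h2]; ring

/-- The Taylor remainder is pointwise at most `K k²`, which is integrable but in general not square
integrable; pairing with a bounded `p` turns it into `K B ‖k‖²`. -/
theorem hasFDerivAt_inner_superpose (h : HasLipschitzDeriv g g' C K) {p : H Ω} {B : ℝ}
    (hp : ∀ᵐ x ∂(volume.restrict Ω), |p x| ≤ B) (f : H Ω) :
    HasFDerivAt (fun f => ⟪superpose Ω g f, p⟫) (innerSL ℝ (h.derivMul f p)) f := by
  rw [hasFDerivAt_iff_isLittleO_nhds_zero]
  refine Asymptotics.IsBigO.trans_isLittleO (g := fun k : H Ω => ‖k‖ ^ 2) ?_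
    (Asymptotics.isLittleO_norm_pow_id one_lt_two)
  refine Asymptotics.IsBigO.of_bound (K * B) (Eventually.of_forall fun k => ?_)
  rw [innerSL_apply_apply, h.inner_derivMul, ← inner_sub_left, ← inner_sub_left, norm_pow,
    norm_norm, ← real_inner_self_eq_norm_sq, inner_H_eq, inner_H_eq, ← integral_const_mul]
  have hi : Integrable (fun x => k x * k x) (volume.restrict Ω) :=
    (Lp.memLp k).integrable_mul (Lp.memLp k)
  refine norm_integral_le_of_norm_le (hi.const_mul _) ?_
  filter_upwards [Lp.coeFn_sub (superpose Ω g (f + k) - superpose Ω g f) (h.derivMul f k),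
    Lp.coeFn_sub (superpose Ω g (f + k)) (superpose Ω g f), h.derivMul_ae f k,
    h.superpose_ae f, h.superpose_ae (f + k), Lp.coeFn_add f k, hp] with x h1 h2 h3 h4 h5 h6 h7
  rw [h1, Pi.sub_apply, h2, Pi.sub_apply, h3, h4, h5, h6, Pi.add_apply, norm_mul]
  calc _ ≤ K * (k x) ^ 2 * B :=
        mul_le_mul (h.abs_sub_le _ _) h7 (abs_nonneg _)
          (mul_nonneg h.nonneg_lip (sq_nonneg _))
    _ = K * B * (k x * k x) := by ring

/-- The chain rule for the superposition operator. -/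
theorem isPrim_superpose (h : HasLipschitzDeriv g g' C K) (hΩ : IsOpen Ω) {T : ℝ}
    {f f' : ℝ → H Ω} (hf : IsPrim T f f') :
    IsPrim T (fun t => superpose Ω g (f t)) (fun t => h.derivMul (f t) (f' t)) := by
  have hint : Integrable (fun t => h.derivMul (f t) (f' t)) (timeMeasure T) := by
    refine Integrable.mono' (hf.integrable.norm.const_mul C) ?_
      (Eventually.of_forall fun t => h.norm_derivMul_le _ _)
    exact (h.continuous_derivMul hΩ).comp_aestronglyMeasurable
      (hf.integrable.aestronglyMeasurable.prodMk
        (aestronglyMeasurable_of_continuousOn hf.continuousOn))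
  refine ⟨hint, fun t ht => ?_⟩
  have hI := intervalIntegrable_of_integrable_timeMeasure hint ht
  rw [← sub_eq_zero]
  -- Test functions are bounded, so the scalar chain rule is available for each pairing, and they
  -- determine an element of `L²`.
  refine lp_eq_zero_of_integral_test hΩ _ fun φ hφ hc _ => ?_
  have m : MemLp φ 2 (volume.restrict Ω) := memLp_test hφ.continuous hc
  obtain ⟨B, hB⟩ := hφ.continuous.bounded_above_of_compact_support hc
  have hp : ∀ᵐ x ∂(volume.restrict Ω), |(m.toLp : H Ω) x| ≤ B :=
    m.coeFn_toLp.mono fun x hx => by rw [hx]; exact hB x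
  have key := (hf.chain (h.hasFDerivAt_inner_superpose hp) (L := K * B) fun f₁ f₂ => by
    rw [← map_sub, innerSL_apply_norm]
    exact h.norm_derivMul_sub_le_of_bound f₁ f₂ _ hp).eq t ht
  simp only [innerSL_apply_apply, h.inner_derivMul] at key
  have e1 : ∫ s in (0 : ℝ)..t, ⟪h.derivMul (f s) (f' s), m.toLp⟫
      = ⟪∫ s in (0 : ℝ)..t, h.derivMul (f s) (f' s), m.toLp⟫ := by
    have := ((innerSL ℝ) (m.toLp : H Ω)).intervalIntegral_comp_comm hI
    simpa only [innerSL_apply_apply, real_inner_comm] using this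
  rw [e1, ← sub_eq_zero, ← inner_add_left, ← inner_sub_left, inner_H_eq] at key
  refine Eq.trans ?_ key
  exact integral_congr_ae (m.coeFn_toLp.mono fun x hx => by
    simp only [hx, smul_eq_mul, mul_comm])

end HasLipschitzDeriv

end Superposition

/-! ### The concrete operators and the stress energy -/

section Operators

theorem integrable_bilin_of_continuousOn {X Y Z : Type*} [NormedAddCommGroup X] [NormedSpace ℝ X]
    [NormedAddCommGroup Y] [NormedSpace ℝ Y] [NormedAddCommGroup Z] [NormedSpace ℝ Z]
    (B : X →L[ℝ] Y →L[ℝ] Z) {T : ℝ} {f : ℝ → X} {g : ℝ → Y}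
    (hf : Integrable f (timeMeasure T)) (hg : ContinuousOn g (Icc 0 T)) :
    Integrable (fun t => B (f t) (g t)) (timeMeasure T) := by
  obtain ⟨C, -, hC⟩ := exists_norm_le_of_continuousOn_Icc hg
  refine Integrable.mono' ((hf.norm.const_mul ‖B‖).mul_const C)
    (B.aestronglyMeasurable_comp₂ hf.aestronglyMeasurable
      (aestronglyMeasurable_of_continuousOn hg)) ?_
  filter_upwards [ae_mem_Icc_timeMeasure T] with t ht
  exact (B.le_opNorm₂ _ _).trans (mul_le_mul_of_nonneg_left (hC t ht) (by positivity))

theorem memLp_clm {X Y : Type*} [NormedAddCommGroup X] [NormedSpace ℝ X]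
    [NormedAddCommGroup Y] [NormedSpace ℝ Y] (L : X →L[ℝ] Y) {T : ℝ} {p : ℝ≥0∞} {f : ℝ → X}
    (hf : MemLp f p (timeMeasure T)) : MemLp (fun t => L (f t)) p (timeMeasure T) :=
  L.comp_memLp' hf

theorem memLp_clm_add_sub {X₁ X₂ X₃ Y : Type*} [NormedAddCommGroup X₁] [NormedSpace ℝ X₁]
    [NormedAddCommGroup X₂] [NormedSpace ℝ X₂] [NormedAddCommGroup X₃] [NormedSpace ℝ X₃]
    [NormedAddCommGroup Y] [NormedSpace ℝ Y] (L₁ : X₁ →L[ℝ] Y) (L₂ : X₂ →L[ℝ] Y)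
    (L₃ : X₃ →L[ℝ] Y) {T : ℝ} {p : ℝ≥0∞} {f₁ : ℝ → X₁} {f₂ : ℝ → X₂} {f₃ : ℝ → X₃}
    (h₁ : MemLp f₁ p (timeMeasure T)) (h₂ : MemLp f₂ p (timeMeasure T))
    (h₃ : MemLp f₃ p (timeMeasure T)) :
    MemLp (fun t => L₁ (f₁ t) + L₂ (f₂ t) - L₃ (f₃ t)) p (timeMeasure T) :=
  ((memLp_clm L₁ h₁).add (memLp_clm L₂ h₂)).sub (memLp_clm L₃ h₃)

variable {Ω : Set E3}

/-- The Riesz isomorphism `V* → V`. -/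
noncomputable def riesz (Ω : Set E3) : VDual Ω →L[ℝ] V Ω :=
  LinearMap.mkContinuous
    { toFun := (InnerProductSpace.toDual ℝ (V Ω)).symm
      map_add' := map_add _
      map_smul' := fun c ℓ => by simp } 1 fun ℓ => by
    rw [one_mul]; exact ((InnerProductSpace.toDual ℝ (V Ω)).symm.norm_map ℓ).le

theorem inner_riesz (ℓ : VDual Ω) (v : V Ω) : ⟪riesz Ω ℓ, v⟫ = ℓ v :=
  InnerProductSpace.toDual_symm_apply

theorem riesz_toDual (h : H Ω) : riesz Ω (toDual Ω h) = (toH Ω).adjoint h := by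
  refine ext_inner_right ℝ fun v => ?_
  rw [inner_riesz, ContinuousLinearMap.adjoint_inner_left]
  rfl

/-- The operator `b ↦ (v ↦ ∫_Γ b v)`. -/
noncomputable def bdryL (Ω : Set E3) : L2Bdry Ω →L[ℝ] VDual Ω :=
  ((trace Ω).precomp ℝ).comp (innerSL ℝ)

theorem bdryL_apply (b : L2Bdry Ω) : bdryL Ω b = bdryFunctional Ω b := rfl

theorem memLp_bdryL {T : ℝ} {b : ℝ → L2Bdry Ω} (hb : MemLp b 2 (timeMeasure T)) :
    MemLp (fun t => bdryL Ω (b t)) 2 (timeMeasure T) := by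
  have := memLp_clm (X := L2Bdry Ω) (Y := VDual Ω) (bdryL Ω) hb
  exact this

/-- The operator `F ↦ (v ↦ ∫_Ω F · ∇v)`. -/
noncomputable def negDiv (Ω : Set E3) : HH Ω →L[ℝ] VDual Ω :=
  ((grad Ω).precomp ℝ).comp (innerSL ℝ)

theorem negDiv_apply (F : HH Ω) (v : V Ω) : negDiv Ω F v = ⟪F, grad Ω v⟫ := rfl

theorem memLp_momentum {T : ℝ} {h : ℝ → H Ω} {b : ℝ → L2Bdry Ω} {F : ℝ → HH Ω}
    (hh : MemLp h 2 (timeMeasure T)) (hb : MemLp b 2 (timeMeasure T))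
    (hF : MemLp F 2 (timeMeasure T)) :
    MemLp (fun t => toDual Ω (h t) + bdryL Ω (b t) - negDiv Ω (F t)) 2 (timeMeasure T) := by
  have := memLp_clm_add_sub (X₁ := H Ω) (X₂ := L2Bdry Ω) (X₃ := HH Ω) (Y := VDual Ω) (toDual Ω)
    (bdryL Ω) (negDiv Ω) hh hb hF
  exact this

theorem IsPrim.toDual {T : ℝ} {h h' : ℝ → H Ω} (hp : IsPrim T h h') :
    IsPrim T (fun t => toDual Ω (h t)) (fun t => toDual Ω (h' t)) := by
  have := hp.clm (Y := VDual Ω) (Thermo.toDual Ω)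
  exact this

theorem memLp_toDual_of_continuousOn {T : ℝ} {h : ℝ → H Ω} (hc : ContinuousOn h (Icc 0 T)) :
    MemLp (fun t => toDual Ω (h t)) 2 (timeMeasure T) := by
  have := memLp_clm (X := H Ω) (Y := VDual Ω) (toDual Ω) (memLp_top_of_continuousOn hc 2)
  exact this

theorem memBochnerSobolev_two_toDual {T : ℝ} (hT : 0 < T) {h h' : ℝ → H Ω} {k : ℝ → VDual Ω}
    (hp : IsPrim T h h') (hc : ContinuousOn h' (Icc 0 T))
    (hk : IsWeakTimeDeriv T (fun t => toDual Ω (h' t)) k) (hk2 : MemLp k 2 (timeMeasure T)) :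
    MemBochnerSobolev T 2 2 (fun t => toDual Ω (h t)) :=
  ⟨memLp_toDual_of_continuousOn hp.continuousOn, fun t => toDual Ω (h' t),
    hp.toDual.isWeakTimeDeriv hT, memLp_toDual_of_continuousOn hc, k, hk, hk2⟩

/-- The operator `h ↦ h e`. -/
noncomputable def smulDir (Ω : Set E3) (e : E3) : H Ω →L[ℝ] HH Ω :=
  (ContinuousLinearMap.toSpanSingleton ℝ e).compLpL 2 (volume.restrict Ω)

theorem smulDir_ae (e : E3) (h : H Ω) :
    smulDir Ω e h =ᵐ[volume.restrict Ω] fun x => h x • e :=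
  (ContinuousLinearMap.toSpanSingleton ℝ e).coeFn_compLpL h

theorem inner_smulDir (e : E3) (F : HH Ω) (h : H Ω) :
    ⟪F, smulDir Ω e h⟫ = ∫ x in Ω, ⟪F x, e⟫ * h x := by
  rw [L2.inner_def]
  refine integral_congr_ae ?_
  filter_upwards [smulDir_ae e h] with x hx
  rw [hx, real_inner_smul_right, mul_comm]

theorem inner_smulDir_smulDir {e : E3} (he : ‖e‖ = 1) (h k : H Ω) :
    ⟪smulDir Ω e h, smulDir Ω e k⟫ = ⟪h, k⟫ := by
  rw [inner_smulDir, inner_H_eq]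
  refine integral_congr_ae ?_
  filter_upwards [smulDir_ae e h] with x hx
  rw [hx, real_inner_smul_left, real_inner_self_eq_norm_sq, he, one_pow, mul_one]

theorem integral_sq_H (h : H Ω) : ∫ x in Ω, (h x) ^ 2 = ‖h‖ ^ 2 := by
  rw [← real_inner_self_eq_norm_sq, inner_H_eq]
  simp only [pow_two]

theorem integral_norm_sq_HH (F : HH Ω) : ∫ x in Ω, ‖F x‖ ^ 2 = ‖F‖ ^ 2 := by
  rw [← real_inner_self_eq_norm_sq, L2.inner_def]
  simp only [real_inner_self_eq_norm_sq]

theorem HasInitialValue.eq_of_isContRep {X : Type*} [NormedAddCommGroup X] [NormedSpace ℝ X]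
    {T : ℝ} (hT : 0 < T) {f g : ℝ → X} {x : X} (h : HasInitialValue T f x)
    (hg : IsContRep T f g) : g 0 = x := by
  obtain ⟨g', hg', rfl⟩ := h
  exact eqOn_Icc_of_ae_eq hT hg.1 hg'.1 (hg.2.symm.trans hg'.2) ⟨le_rfl, hT.le⟩

/-- The energy balance for the stress `σ = κ ∇u - N e`, from the energy balance for the wave
equation. -/
theorem isPrim_stress_energy {T κ : ℝ} {e : E3} (he : ‖e‖ = 1) {u uc : ℝ → V Ω}
    {utc BΩ N dN : ℝ → H Ω} {BΓ dBΓ : ℝ → VDual Ω} (hN : IsPrim T N dN)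
    (hu : IsPrim T (fun t => toH Ω (uc t)) utc) (huc : u =ᵐ[timeMeasure T] uc)
    (hE : IsPrim T
      (fun t => ‖utc t‖ ^ 2 + κ * ‖uc t‖ ^ 2
        - 2 * ⟪riesz Ω (BΓ t) + (grad Ω).adjoint (smulDir Ω e (N t)), uc t⟫)
      (fun t => 2 * ⟪BΩ t + κ • toH Ω (u t), utc t⟫
        - 2 * ⟪riesz Ω (dBΓ t) + (grad Ω).adjoint (smulDir Ω e (dN t)), uc t⟫)) :
    IsPrim T
      (fun t => κ / 2 * ‖utc t‖ ^ 2 + 1 / 2 * ‖κ • grad Ω (uc t) - smulDir Ω e (N t)‖ ^ 2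
        - κ * BΓ t (uc t))
      (fun t => κ * ⟪BΩ t, utc t⟫ - κ * dBΓ t (uc t)
        - ⟪κ • grad Ω (uc t) - smulDir Ω e (N t), smulDir Ω e (dN t)⟫) := by
  -- Expanding the square, `½‖κ∇u - N e‖² = κ²/2 ‖∇u‖² - κ⟪N e, ∇u⟫ + ½‖N‖²`, by `|e| = 1`. The wave
  -- energy times `κ/2` gives the first two terms once the `L²` part of `‖u‖²_V` is removed; the
  -- last one is added.
  have key := ((hE.const_mul (κ / 2)).sub ((hu.inner hu).const_mul (κ ^ 2 / 2))).add
    ((hN.inner hN).const_mul (1 / 2))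
  have e1 : (fun t => κ / 2 * ‖utc t‖ ^ 2
      + 1 / 2 * ‖κ • grad Ω (uc t) - smulDir Ω e (N t)‖ ^ 2 - κ * BΓ t (uc t))
      = fun t => κ / 2 * (‖utc t‖ ^ 2 + κ * ‖uc t‖ ^ 2
        - 2 * ⟪riesz Ω (BΓ t) + (grad Ω).adjoint (smulDir Ω e (N t)), uc t⟫)
        - κ ^ 2 / 2 * ⟪toH Ω (uc t), toH Ω (uc t)⟫ + 1 / 2 * ⟪N t, N t⟫ := by
    funext t
    rw [norm_sub_sq_real, norm_smul, mul_pow, Real.norm_eq_abs, sq_abs, real_inner_smul_left,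
      ← real_inner_self_eq_norm_sq (smulDir Ω e (N t)), inner_smulDir_smulDir he, norm_V_sq,
      inner_add_left, inner_riesz, ContinuousLinearMap.adjoint_inner_left,
      real_inner_self_eq_norm_sq (toH Ω (uc t)), real_inner_comm (smulDir Ω e (N t))]
    ring
  rw [e1]
  refine key.congr_deriv ?_
  filter_upwards [huc] with t ht
  rw [ht]
  simp only [inner_add_left, inner_sub_left, real_inner_smul_left, inner_riesz,
    ContinuousLinearMap.adjoint_inner_left, inner_smulDir_smulDir he]
  rw [real_inner_comm (utc t) (toH Ω (uc t)), real_inner_comm (N t) (dN t),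
    real_inner_comm (grad Ω (uc t)) (smulDir Ω e (dN t))]
  ring

end Operators

end Thermo

/-! ### The theorem: reduction to the abstract wave equation -/

set_option maxHeartbeats 1000000 in
theorem lemma4p1
    -- the domain, the final time and the constants
    (Ω : Set E3) (hΩo : IsOpen Ω) (hΩb : Bornology.IsBounded Ω) (hΩs : HasSmoothBoundary Ω)
    (T : ℝ) (hT : 0 < T) (κ : ℝ) (hκ : 0 < κ) (e : E3) (he : ‖e‖ = 1)
    -- the nonlinearities `G` and `γ = G sign`
    (G γ : ℝ → ℝ) (hG : ContDiff ℝ 1 G) (hGnn : ∀ r, 0 ≤ G r) (hG0 : G 0 = 0)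
    (hGb : ∃ C, ∀ r, |G r| ≤ C) (hG'b : ∃ C, ∀ r, |deriv G r| ≤ C)
    (hG'L : ∃ K, LipschitzWith K (deriv G)) (hγ : ∀ r, γ r = G r * Real.sign r)
    -- the forcing terms `B_Ω ∈ L²(0,T;H)` and `b_Γ ∈ H¹(0,T;L²(Γ))`, the initial data
    (BΩ : ℝ → H Ω) (hBΩ : MemLp BΩ 2 (timeMeasure T))
    (b : ℝ → L2Bdry Ω) (hb : MemBochnerSobolev T 1 2 b)
    (u0 : V Ω) (u0' : H Ω)
    -- `u ∈ W^{2,1}(V*) ∩ W^{1,∞}(H) ∩ L^∞(V)`, with `∂ₜu = ut` and `∂ₜ²u = utt`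
    (u : ℝ → V Ω) (hu21 : MemBochnerSobolev T 2 1 (fun t => toDual Ω (toH Ω (u t))))
    (hu1 : MemBochnerSobolev T 1 ∞ (fun t => toH Ω (u t)))
    (hu0 : MemLp u ∞ (timeMeasure T))
    (ut : ℝ → H Ω) (hut : IsWeakTimeDeriv T (fun t => toH Ω (u t)) ut)
    (utt : ℝ → VDual Ω) (hutt : IsWeakTimeDeriv T (fun t => toDual Ω (ut t)) utt)
    -- `σ ∈ L^∞(H³)` and `χ ∈ H¹(H)`
    (σ : ℝ → HH Ω) (hσ : MemLp σ ∞ (timeMeasure T))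
    (χ : ℝ → H Ω) (hχ : MemBochnerSobolev T 1 2 χ)
    -- `σ = κ ∇u - γ(χ) e`
    (hσeq : ∀ᵐ t ∂(timeMeasure T), ∀ᵐ x ∂(volume.restrict Ω),
      σ t x = κ • grad Ω (u t) x - γ (χ t x) • e)
    -- the momentum equation
    (hmom : ∀ᵐ t ∂(timeMeasure T), ∀ v : V Ω,
      utt t v + ∫ x in Ω, ⟪σ t x, grad Ω v x⟫
        = (toDual Ω (BΩ t) + bdryFunctional Ω (b t)) v)
    -- the initial conditions
    (hin : HasInitialValue T (fun t => toH Ω (u t)) (toH Ω u0))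
    (hin' : HasInitialValue T (fun t => toDual Ω (ut t)) (toDual Ω u0')) :
    -- the representatives of `u` in `C⁰(V) ∩ C¹(H)`, of `∂ₜu` in `C⁰(H)`, of `σ` in `C⁰(H³)` and
    -- of `B_Γ` in `C⁰(V*)`, and the derivatives `∂ₜγ(χ)` and `∂ₜB_Γ`
    ∃ (uc : ℝ → V Ω) (utc : ℝ → H Ω) (σc : ℝ → HH Ω) (BΓ : ℝ → VDual Ω)
      (dγ : ℝ → H Ω) (dBΓ : ℝ → VDual Ω),
      IsContRep T u uc ∧
      IsC1With T (fun t => toH Ω (uc t)) utc ∧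
      MemBochnerSobolev T 2 2 (fun t => toDual Ω (toH Ω (uc t))) ∧
      IsContRep T σ σc ∧
      IsContRep T (fun t => bdryFunctional Ω (b t)) BΓ ∧
      IsWeakTimeDeriv T (fun t => superpose Ω γ (χ t)) dγ ∧ MemLp dγ 2 (timeMeasure T) ∧
      IsWeakTimeDeriv T BΓ dBΓ ∧ MemLp dBΓ 2 (timeMeasure T) ∧
      ∀ t ∈ Icc 0 T,
        κ / 2 * (∫ x in Ω, (utc t x) ^ 2) - κ / 2 * (∫ x in Ω, (u0' x) ^ 2)
          + 1 / 2 * (∫ x in Ω, ‖σc t x‖ ^ 2) - 1 / 2 * (∫ x in Ω, ‖σc 0 x‖ ^ 2)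
          + (∫ s in (0 : ℝ)..t, ∫ x in Ω, ⟪σc s x, e⟫ * dγ s x)
        = κ * (∫ s in (0 : ℝ)..t, ∫ x in Ω, BΩ s x * utc s x)
          + κ * BΓ t (uc t) - κ * BΓ 0 u0
          - κ * (∫ s in (0 : ℝ)..t, dBΓ s (uc s)) := by
  obtain ⟨C, hC⟩ := hG'b
  obtain ⟨K, hK⟩ := hG'L
  have hγL := hasLipschitzDeriv_mul_sign hG hGnn hG0 hC hK hγ
  -- the absolutely continuous representatives of `χ`, `b`, `u` and `∂ₜu`
  obtain ⟨-, χ', hχw, hχ'2⟩ := hχ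
  obtain ⟨χc, hχc, hχχc⟩ := hχw.exists_isPrim hT
  obtain ⟨-, b', hbw, hb'2⟩ := hb
  obtain ⟨bc, hbc, hbbc⟩ := hbw.exists_isPrim hT
  obtain ⟨g1, hg1, hug1⟩ := hut.exists_isPrim hT
  obtain ⟨g2, hg2, hug2⟩ := hutt.exists_isPrim hT
  replace hχ'2 : MemLp χ' 2 (timeMeasure T) := hχ'2
  replace hb'2 : MemLp b' 2 (timeMeasure T) := hb'2
  have hN := hγL.isPrim_superpose hΩo hχc
  have hBΓ := hbc.clm (Y := VDual Ω) (bdryL Ω)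
  have hσLp : ∀ᵐ t ∂(timeMeasure T),
      σ t = κ • grad Ω (u t) - smulDir Ω e (superpose Ω γ (χ t)) := by
    filter_upwards [hσeq] with t ht
    refine Lp.ext ?_
    filter_upwards [ht, Lp.coeFn_sub (κ • grad Ω (u t)) (smulDir Ω e (superpose Ω γ (χ t))),
      Lp.coeFn_smul κ (grad Ω (u t)), smulDir_ae e (superpose Ω γ (χ t)),
      hγL.superpose_ae (χ t)] with x h1 h2 h3 h4 h5
    rw [h1, h2, Pi.sub_apply, h3, h4, h5, Pi.smul_apply]
  have hutt_eq : ∀ᵐ t ∂(timeMeasure T),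
      utt t = toDual Ω (BΩ t) + bdryL Ω (b t) - negDiv Ω (σ t) := by
    filter_upwards [hmom] with t ht
    ext v
    have h1 : ∫ x in Ω, ⟪σ t x, grad Ω v x⟫ = negDiv Ω (σ t) v := by
      rw [negDiv_apply, L2.inner_def]
    rw [sub_apply, ← h1]
    exact eq_sub_of_add_eq (ht v)
  -- Through Riesz, `κ u` represents `κ ∫ u v + κ ∫ ∇u·∇v`, while the momentum equation contains
  -- only the gradient part; hence the extra `κ • toH Ω (u t)` in the forcing.
  have hwave : IsWave T κ (toH Ω) u (fun t => (toH Ω).adjoint (g1 t)) (fun t => riesz Ω (g2 t))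
      (fun t => riesz Ω (utt t)) (fun t => BΩ t + κ • toH Ω (u t))
      (fun t => riesz Ω (bdryL Ω (bc t))
        + (grad Ω).adjoint (smulDir Ω e (superpose Ω γ (χc t))))
      (fun t => riesz Ω (bdryL Ω (b' t))
        + (grad Ω).adjoint (smulDir Ω e (hγL.derivMul (χc t) (χ' t)))) u0 u0' := by
    refine ⟨?_, hg2.clm (riesz Ω), ?_, ?_, ?_, ?_, ?_, ?_⟩
    · refine (hg1.clm (toH Ω).adjoint).congr_deriv ?_
      filter_upwards [hug2] with t ht
      rw [← ht, riesz_toDual]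
    · filter_upwards [hug1] with t ht
      rw [← ht]
    · rw [hin.eq_of_isContRep hT ⟨hg1.continuousOn, hug1⟩]
    · rw [hin'.eq_of_isContRep hT ⟨hg2.continuousOn, hug2⟩, riesz_toDual]
    · exact (hBΩ.integrable one_le_two).add (hut.1.smul κ)
    · have h1 := hBΓ.clm (riesz Ω)
      have h2 := hN.clm ((grad Ω).adjoint.comp (smulDir Ω e))
      exact h1.add h2
    · filter_upwards [hutt_eq, hσLp, hχχc, hbbc] with t h1 h2 h3 h4
      refine ext_inner_right ℝ fun v => ?_
      rw [h1, h2, ← h3, ← h4]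
      simp only [inner_add_left, inner_riesz, real_inner_smul_left, sub_apply, add_apply,
        negDiv_apply, inner_sub_left, ContinuousLinearMap.adjoint_inner_left]
      have h5 : toDual Ω (BΩ t) v = ⟪BΩ t, toH Ω v⟫ := rfl
      rw [h5, inner_V_eq (u t) v]
      ring
  obtain ⟨uc, utc, hucc, hutcc, huuc, hututc, huc0, hutc0, hprim, henergy⟩ :=
    hwave.exists_continuous_energy hκ hT (injective_toH hΩo) (denseRange_toH hΩo) (ut := ut) (by
      filter_upwards [hug2] with t ht
      rw [← ht, riesz_toDual])
  have hstress := isPrim_stress_energy (BΩ := BΩ) (N := fun t => superpose Ω γ (χc t))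
    (dN := fun t => hγL.derivMul (χc t) (χ' t)) (BΓ := fun t => bdryL Ω (bc t))
    (dBΓ := fun t => bdryL Ω (b' t)) he hN hprim huuc henergy
  have hσcc : ContinuousOn (fun t => κ • grad Ω (uc t) - smulDir Ω e (superpose Ω γ (χc t)))
      (Icc 0 T) :=
    (((grad Ω).continuous.comp_continuousOn hucc).const_smul κ).sub
      ((smulDir Ω e).continuous.comp_continuousOn hN.continuousOn)
  have hdγ2 : MemLp (fun t => hγL.derivMul (χc t) (χ' t)) 2 (timeMeasure T) :=
    MemLp.of_le_mul hχ'2 hN.integrable.aestronglyMeasurable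
      (Eventually.of_forall fun t => hγL.norm_derivMul_le _ _)
  have hdB2 : MemLp (fun t => bdryL Ω (b' t)) 2 (timeMeasure T) :=
    memLp_bdryL hb'2
  refine ⟨uc, utc, fun t => κ • grad Ω (uc t) - smulDir Ω e (superpose Ω γ (χc t)),
    fun t => bdryL Ω (bc t), fun t => hγL.derivMul (χc t) (χ' t), fun t => bdryL Ω (b' t),
    ⟨hucc, huuc⟩, ⟨fun t ht => hprim.hasDerivWithinAt hutcc ht, hutcc⟩, ?_, ⟨hσcc, ?_⟩,
    ⟨hBΓ.continuousOn, ?_⟩, ?_, hdγ2, hBΓ.isWeakTimeDeriv hT, hdB2, ?_⟩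
  · refine memBochnerSobolev_two_toDual hT hprim hutcc
      (hutt.congr (hututc.mono fun t ht => by simp only [ht]) EventuallyEq.rfl) ?_
    have hb2 : MemLp b 2 (timeMeasure T) :=
      (memLp_top_of_continuousOn hbc.continuousOn 2).ae_eq hbbc.symm
    -- The gain from `L¹` to `L²` for `∂ₜ²u` is read off the equation, all of whose other terms are
    -- square integrable in time.
    have h1 := memLp_momentum hBΩ hb2 (hσ.mono_exponent (p := 2) le_top)
    exact h1.ae_eq (hutt_eq.mono fun t ht => ht.symm)
  · filter_upwards [hσLp, huuc, hχχc] with t h1 h2 h3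
    rw [h1, h2, h3]
  · filter_upwards [hbbc] with t ht
    rw [ht, bdryL_apply]
  · refine (hN.isWeakTimeDeriv hT).congr ?_ EventuallyEq.rfl
    filter_upwards [hχχc] with t ht
    rw [ht]
  · intro t ht
    have hi1 : Integrable (fun s => κ * ⟪BΩ s, utc s⟫) (timeMeasure T) :=
      (integrable_bilin_of_continuousOn (innerSL ℝ) (hBΩ.integrable one_le_two) hutcc).const_mul κ
    have hi2 : Integrable (fun s => κ * bdryL Ω (b' s) (uc s)) (timeMeasure T) :=
      (integrable_bilin_of_continuousOn (ContinuousLinearMap.id ℝ (VDual Ω)) hBΓ.integrable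
        hucc).const_mul κ
    have hi3 : Integrable (fun s => ⟪κ • grad Ω (uc s) - smulDir Ω e (superpose Ω γ (χc s)),
        smulDir Ω e (hγL.derivMul (χc s) (χ' s))⟫) (timeMeasure T) := by
      simp only [real_inner_comm (smulDir Ω e _)]
      exact integrable_bilin_of_continuousOn (innerSL ℝ)
        ((smulDir Ω e).integrable_comp hN.integrable) hσcc
    have key := hstress.eq t ht
    have j1 := intervalIntegrable_of_integrable_timeMeasure hi1 ht
    have j2 := intervalIntegrable_of_integrable_timeMeasure hi2 ht
    have j3 := intervalIntegrable_of_integrable_timeMeasure hi3 ht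
    rw [intervalIntegral.integral_sub (j1.sub j2) j3, intervalIntegral.integral_sub j1 j2,
      intervalIntegral.integral_const_mul, intervalIntegral.integral_const_mul, huc0, hutc0] at key
    simp only [integral_sq_H, integral_norm_sq_HH, ← inner_smulDir, ← inner_H_eq, huc0]
    linarith
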